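/- A pointed metric measure space $(X,d,m,x)$ is a complete separable metric space $(X,d)$ with a nonnegative Borel measure $m$ that is finite on bounded sets, and a point $x\in X$. Let $(X_n,d_n,m_n,x_n)$, $n\in\mathbb N$, and $(X_\infty,d_\infty,m_\infty,x_\infty)$ be pointed metric measure spaces such that $X_n\to X_\infty$ in the pointed measured Gromov–Hausdorff sense, and fix a realization: a complete separable metric space $(Z,d)$ and isometric embeddings $\iota_n:X_n\to Z$, $\iota_\infty:X_\infty\to Z$ with $\iota_n(x_n)\to\iota_\infty(x_\infty)$ and $(\iota_n)_\sharp m_n\to(\iota_\infty)_\sharp m_\infty$ in duality with the space $C_{bs}(Z)$ of bounded continuous functions with bounded support. Identify $X_n$ and $X_\infty$ with their images in $Z$. For $\mu,\nu$ boundedly supported Borel probability measures on $X$ put $W_\infty(\mu,\nu)=\inf_\alpha\|d(\cdot,\cdot)\|_{L^\infty(\alpha)}$, the infimum over all measures $\alpha$ on $X\times X$ with marginals $\mu,\nu$. For $q\in[1,\infty)$, functions $f_n\in L^q(m_n)$ converge $L^q$-weakly to $f\in L^q(m_\infty)$ if $\sup_n\|f_n\|_{L^q(m_n)}<\infty$ and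 $f_nm_n\to f m_\infty$ in duality with $C_{bs}(Z)$. For $q\in(1,\infty)$ they converge $L^q$-strongly if moreover $\limsup_n\|f_n\|_{L^q(m_n)}\le\|f\|_{L^q(m_\infty)}$. For $q=1$, $f_n\in L^1(m_n)$ converges $L^1$-strongly to $f\in L^1(m_\infty)$ if $\sigma\circ f_n$ converges $L^2$-strongly to $\sigma\circ f$, where $\sigma(t)=\operatorname{sgn}(t)\sqrt{|t|}$. Let $M\in\mathbb N$ (including $0$) and let $\rho_0,\dots,\rho_M\in L^\infty(m_\infty)$ be probability densities with respect to $m_\infty$, all with (essential) support contained in $\overline B=\{y\in Z: d(y,z)\le r\}$ for some $z\in Z$ and $r>0$. Let $2B=\{y\in Z: d(y,z)<2r\}$. Then $m_n(2B)>0$ for all sufficiently large $n$, and there are functions $\rho_{i,n}\in L^\infty(m_n)$, $i=0,\dots,M$, $n\in\mathbb N$, such that for every $n$ with $m_n(2B)>0$ each $\rho_{i,n}$ is a probability density with respect to $m_n$ with (essential) support contained in $2B$, and: (a) $\limsup_{n\to\infty}W_\infty(\rho_{i,n}m_n,\rho_{i+1,n}m_n)\le W_\infty(\rho_im_\infty,\rho_{i+1}m_\infty)$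 for all $i=0,\dots,M-1$; (b) $\limsup_{n\to\infty}\|\rho_{i,n}\|_{L^\infty(m_n)}\le\|\rho_i\|_{L^\infty(m_\infty)}$ for all $i=0,\dots,M$; (c) $\rho_{i,n}\to\rho_i$ $L^q$-strongly as $n\to\infty$, for all $q\in[1,\infty)$ and $i=0,\dots,M$. -/

import Mathlib

open MeasureTheory Filter Topology
open scoped ENNReal BoundedContinuousFunction

noncomputable section

namespace PMGH

universe u v w

/-- A measure on a metric space is boundedly finite if bounded sets have finite mass. -/
def BoundedlyFinite {X : Type u} [MetricSpace X] [MeasurableSpace X] (m : Measure X) : Prop :=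
  ∀ s : Set X, Bornology.IsBounded s → m s < ∞

/-- The set `C_bs(Z)` of bounded continuous real functions on `Z` with bounded support. -/
def Cbs (Z : Type w) [MetricSpace Z] : Set (Z →ᵇ ℝ) :=
  {φ | Bornology.IsBounded (tsupport (φ : Z → ℝ))}

/-- The maps `ι n : X n → Z` and `ιinf : Xinf → Z` realize, in the metric space `Z`, the pointed
measured Gromov-Hausdorff convergence of `(X n, m n, x n)` to `(Xinf, minf, xinf)`: they are
isometric embeddings, the base points converge, and the push-forward measures converge in duality
with `C_bs(Z)`. (Completeness and separability of all the spaces are type class assumptions.) -/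
structure IsRealization {X : ℕ → Type u} {Xinf : Type v} {Z : Type w}
    [∀ n, MetricSpace (X n)] [∀ n, MeasurableSpace (X n)]
    [MetricSpace Xinf] [MeasurableSpace Xinf] [MetricSpace Z] [MeasurableSpace Z]
    (m : ∀ n, Measure (X n)) (x : ∀ n, X n) (minf : Measure Xinf) (xinf : Xinf)
    (ι : ∀ n, X n → Z) (ιinf : Xinf → Z) : Prop where
  isometry : ∀ n, Isometry (ι n)
  isometry_inf : Isometry ιinf
  tendsto_point : Tendsto (fun n => ι n (x n)) atTop (𝓝 (ιinf xinf))
  tendsto_measure : ∀ φ ∈ Cbs Z,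
    Tendsto (fun n => ∫ z, φ z ∂((m n).map (ι n))) atTop (𝓝 (∫ z, φ z ∂(minf.map ιinf)))

/-- `ρ` belongs to `L^∞(m)` and is a probability density with respect to `m`. -/
structure IsBoundedProbDensity {X : Type u} [MeasurableSpace X] (m : Measure X) (ρ : X → ℝ) :
    Prop where
  memLp_top : MemLp ρ ∞ m
  nonneg : 0 ≤ᵐ[m] ρ
  lintegral_eq_one : ∫⁻ a, ENNReal.ofReal (ρ a) ∂m = 1

/-- The measure `ρ m` with density `ρ ≥ 0` with respect to `m`. -/
def densityMeasure {X : Type u} [MeasurableSpace X] (m : Measure X) (ρ : X → ℝ) : Measure X :=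
  m.withDensity (fun a => ENNReal.ofReal (ρ a))

/-- The essential support of `f` with respect to `m`, i.e. the support of the measure `|f| m`. -/
def essSupport {X : Type u} [TopologicalSpace X] [MeasurableSpace X] (m : Measure X)
    (f : X → ℝ) : Set X :=
  (m.withDensity (fun a => ‖f a‖ₑ)).support

/-- The admissible plans between `μ` and `ν`: measures on `X × X` with marginals `μ` and `ν`. -/
def Adm {X : Type u} [MeasurableSpace X] (μ ν : Measure X) : Set (Measure (X × X)) :=
  {α | α.map Prod.fst = μ ∧ α.map Prod.snd = ν}

/-- The `∞`-Wasserstein distance: the infimum over admissible plans `α` of the `L^∞(α)`-norm of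
the distance function. -/
def Winf {X : Type u} [MetricSpace X] [MeasurableSpace X] (μ ν : Measure X) : ℝ≥0∞ :=
  ⨅ α ∈ Adm μ ν, eLpNorm (fun p : X × X => dist p.1 p.2) ∞ α

/-- `L^p`-weak convergence, `p ∈ [1,∞)`, of `f n ∈ L^p(m n)` to `finf ∈ L^p(minf)` along the
embeddings `ι n`, `ιinf` into `Z`: the norms are bounded and `f n · m n` converges to
`finf · minf` in duality with `C_bs(Z)`. -/
structure WeakLpConv {X : ℕ → Type u} {Xinf : Type v} {Z : Type w}
    [∀ n, MeasurableSpace (X n)] [MeasurableSpace Xinf] [MetricSpace Z]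
    (m : ∀ n, Measure (X n)) (minf : Measure Xinf) (ι : ∀ n, X n → Z) (ιinf : Xinf → Z)
    (p : ℝ≥0∞) (f : ∀ n, X n → ℝ) (finf : Xinf → ℝ) : Prop where
  memLp : ∀ n, MemLp (f n) p (m n)
  memLp_inf : MemLp finf p minf
  bounded : ⨆ n, eLpNorm (f n) p (m n) < ∞
  tendsto : ∀ φ ∈ Cbs Z,
    Tendsto (fun n => ∫ a, φ (ι n a) * f n a ∂(m n)) atTop (𝓝 (∫ a, φ (ιinf a) * finf a ∂minf))

/-- `L^p`-strong convergence for `p ∈ (1,∞)`: `L^p`-weak convergence together with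
`limsup ‖f n‖_p ≤ ‖finf‖_p`. -/
structure StrongLpConvAux {X : ℕ → Type u} {Xinf : Type v} {Z : Type w}
    [∀ n, MeasurableSpace (X n)] [MeasurableSpace Xinf] [MetricSpace Z]
    (m : ∀ n, Measure (X n)) (minf : Measure Xinf) (ι : ∀ n, X n → Z) (ιinf : Xinf → Z)
    (p : ℝ≥0∞) (f : ∀ n, X n → ℝ) (finf : Xinf → ℝ) : Prop where
  weak : WeakLpConv m minf ι ιinf p f finf
  limsup_le : limsup (fun n => eLpNorm (f n) p (m n)) atTop ≤ eLpNorm finf p minf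

/-- The signed square root `σ(z) = sgn(z) √|z|`. -/
def signedSqrt (z : ℝ) : ℝ := Real.sign z * √|z|

/-- `L^p`-strong convergence for `p ∈ [1,∞)`. For `p = 1` it means that `f n ∈ L^1(m n)`,
`finf ∈ L^1(minf)`, and the signed square roots `σ ∘ f n` converge `L^2`-strongly to
`σ ∘ finf`. -/
def StrongLpConv {X : ℕ → Type u} {Xinf : Type v} {Z : Type w}
    [∀ n, MeasurableSpace (X n)] [MeasurableSpace Xinf] [MetricSpace Z]
    (m : ∀ n, Measure (X n)) (minf : Measure Xinf) (ι : ∀ n, X n → Z) (ιinf : Xinf → Z)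
    (p : ℝ≥0∞) (f : ∀ n, X n → ℝ) (finf : Xinf → ℝ) : Prop :=
  if p = 1 then
    (∀ n, MemLp (f n) 1 (m n)) ∧ MemLp finf 1 minf ∧
      StrongLpConvAux m minf ι ιinf 2 (fun n a => signedSqrt (f n a))
        (fun a => signedSqrt (finf a))
  else StrongLpConvAux m minf ι ιinf p f finf

end PMGH

end

/-!
The densities `ρ i` on the limit space are discretized at a small scale and their cell masses are
redistributed on the spaces `X n` in proportion to the measures `m n`.

At a fixed precision `ε`, nearly optimal plans between consecutive measures `ρ i • minf` are glued
to the law of one chain of random variables `Y 0, …, Y M` (`exists_near_optimal_chain`). A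
continuous partition of unity `χ j` on `Z` with members of diameter of order `ε` replaces a partition
into cells: the masses of its members converge directly by the assumed weak convergence, so no
boundaries have to be controlled. As the closed ball need not be totally bounded, the chain is
conditioned on the event that all its variables lie where finitely many of the `χ j` add up to `1`;
this event has probability close to `1`, and conditioning the chain as a whole keeps consecutive
marginals coupled. The conditional masses `E[χ j (Y i)]` and `E[χ j (Y i) χ k (Y (i + 1))]` define
the approximating densities on `X n` (`smear`) and plans between them (`smearPlan`). Sending mass
from `χ j` to `χ k` costs at most the displacement of the chain plus the diameters of the members,
which gives the Wasserstein bound; the quotients of masses give the `L^∞` bound. This is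
`eventually_exists_isLevelApprox`.

The same construction satisfies an `L¹` estimate: for a Lipschitz test function `g`, the distance of
the new density to `g` exceeds that of `ρ i` to `g` by an error which is explicit in `ε`
(`integral_abs_smear_sub_le_of_near`). Letting `ε` tend to `0` slowly along the sequence yields
densities which are asymptotically as close as `ρ i` to every such `g` (`L1Close`). Lipschitz
functions with bounded support are dense in `L¹` (`exists_lipschitz_integral_abs_sub_le`), hence
`F ∘ f n` converges weakly to `F ∘ ρ i` for every continuous `F` (`tendsto_integral_mul_comp`).
Taking for `F` the identity, the signed square root and the powers of their absolute values gives
weak convergence and convergence of norms for all exponents at once, including the definition of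
strong convergence for the exponent `1`.
-/

namespace PMGH


/-! ### A partition of unity by small bumps -/

/-- The bump of radius `δ` at `c`: it equals `1` at distance at most `δ / 2` from `c` and vanishes
at distance at least `δ`. -/
noncomputable def bump {Z : Type*} [MetricSpace Z] (δ : ℝ) (c x : Z) : ℝ :=
  max 0 (min 1 (2 - 2 * dist x c / δ))

/-- The `j`-th member of the partition of unity obtained from the bumps at `c 0, c 1, …` by
giving to each centre what the previous ones have left. -/
noncomputable def pou {Z : Type*} [MetricSpace Z] (δ : ℝ) (c : ℕ → Z) (j : ℕ) (x : Z) : ℝ :=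
  bump δ (c j) x * ∏ l ∈ Finset.range j, (1 - bump δ (c l) x)

section PartitionOfUnity

variable {Z : Type*} [MetricSpace Z] {δ : ℝ} {c : ℕ → Z}

lemma bump_nonneg (a x : Z) : 0 ≤ bump δ a x := le_max_left _ _

lemma bump_le_one (a x : Z) : bump δ a x ≤ 1 := max_le zero_le_one (min_le_left _ _)

lemma continuous_bump (a : Z) : Continuous (bump δ a) := by
  unfold bump; fun_prop

lemma continuous_pou (j : ℕ) : Continuous (pou δ c j) := by
  unfold pou
  exact (continuous_bump _).mul
    (continuous_finsetProd _ fun l _ => continuous_const.sub (continuous_bump _))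

lemma pou_nonneg (j : ℕ) (x : Z) : 0 ≤ pou δ c j x :=
  mul_nonneg (bump_nonneg _ _)
    (Finset.prod_nonneg fun _ _ => sub_nonneg.2 (bump_le_one _ _))

lemma sum_pou (J : ℕ) (x : Z) :
    ∑ j ∈ Finset.range J, pou δ c j x = 1 - ∏ l ∈ Finset.range J, (1 - bump δ (c l) x) := by
  induction J with
  | zero => simp
  | succ J ih => rw [Finset.sum_range_succ, ih, Finset.prod_range_succ, pou]; ring

lemma sum_pou_le_one (J : ℕ) (x : Z) : ∑ j ∈ Finset.range J, pou δ c j x ≤ 1 := by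
  rw [sum_pou]
  linarith [Finset.prod_nonneg (s := Finset.range J)
    fun l _ => sub_nonneg.2 (bump_le_one (δ := δ) (c l) x)]

lemma pou_le_one (j : ℕ) (x : Z) : pou δ c j x ≤ 1 :=
  (Finset.single_le_sum (f := fun j => pou δ c j x) (fun i _ => pou_nonneg i x)
    (Finset.mem_range.2 j.lt_succ_self)).trans (sum_pou_le_one (j + 1) x)

lemma dist_lt_of_pou_ne_zero (hδ : 0 < δ) {j : ℕ} {x : Z} (h : pou δ c j x ≠ 0) :
    dist x (c j) < δ := by
  by_contra! hd
  apply h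
  have : 2 - 2 * dist x (c j) / δ ≤ 0 := by
    rw [sub_nonpos, le_div_iff₀ hδ]; linarith
  rw [pou, bump, max_eq_left ((min_le_right _ _).trans this), zero_mul]

lemma sum_pou_eq_one (hδ : 0 < δ) {J l : ℕ} (hl : l < J) {x : Z} (h : dist x (c l) ≤ δ / 2) :
    ∑ j ∈ Finset.range J, pou δ c j x = 1 := by
  have h1 : bump δ (c l) x = 1 := by
    have : 1 ≤ 2 - 2 * dist x (c l) / δ := by
      rw [le_sub_comm, div_le_iff₀ hδ]; linarith
    rw [bump, min_eq_left this, max_eq_right zero_le_one]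
  rw [sum_pou, Finset.prod_eq_zero (Finset.mem_range.2 hl) (by rw [h1, sub_self]), sub_zero]

end PartitionOfUnity

/-! ### Gluing a chain of plans -/

section Gluing

open ProbabilityTheory

/-- Plans with matching marginals are the laws of the successive pairs of one sequence of random
variables. The next variable is sampled from the conditional law of the next plan. -/
theorem exists_chain_of_plans.{u} {X : Type u} [MeasurableSpace X] [StandardBorelSpace X] [Nonempty X]
    (μ : ℕ → Measure X) [∀ i, IsProbabilityMeasure (μ i)] (α : ℕ → Measure (X × X)) (M : ℕ)
    (hα : ∀ i < M, α i ∈ Adm (μ i) (μ (i + 1))) :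
    ∃ (Ω : Type u) (_ : MeasurableSpace Ω) (P : Measure Ω) (Y : ℕ → Ω → X),
      IsProbabilityMeasure P ∧ (∀ i, Measurable (Y i)) ∧ (∀ i ≤ M, P.map (Y i) = μ i) ∧
      ∀ i < M, P.map (fun ω => (Y i ω, Y (i + 1) ω)) = α i := by
  induction M with
  | zero =>
    refine ⟨X, inferInstance, μ 0, fun _ => id, inferInstance, fun _ => measurable_id, ?_, ?_⟩
    · intro i hi
      obtain rfl : i = 0 := by omega
      exact Measure.map_id
    · intro i hi; omega
  | succ M ih =>
    obtain ⟨Ω, _, P, Y, hP, hY, hlaw, hpair⟩ := ih fun i hi => hα i (by omega)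
    obtain ⟨h1, h2⟩ := hα M (by omega)
    have hfin : IsProbabilityMeasure (α M) := by
      constructor
      rw [← Set.preimage_univ (f := Prod.fst), ← Measure.map_apply measurable_fst .univ, h1]
      exact measure_univ
    set κ : Kernel Ω X := (α M).condKernel.comap (Y M) (hY M)
    let Y' : ℕ → Ω × X → X := fun i p => if i ≤ M then Y i p.1 else p.2
    have hY' : ∀ i, Measurable (Y' i) := by
      intro i
      by_cases hi : i ≤ M
      · simpa only [Y', hi, if_true] using! (hY i).comp measurable_fst
      · simpa only [Y', hi, if_false] using measurable_snd
    have hold : ∀ (f : Ω → X × X), Measurable f →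
        (P ⊗ₘ κ).map (fun p => f p.1) = P.map f := by
      intro f hf
      conv_rhs => rw [← Measure.fst_compProd P κ, Measure.fst, Measure.map_map hf measurable_fst]
      rfl
    have hnew : (P ⊗ₘ κ).map (fun p => (Y M p.1, p.2)) = α M := by
      have hm : Measurable fun p : Ω × X => (Y M p.1, p.2) :=
        ((hY M).comp measurable_fst).prodMk measurable_snd
      ext s hs
      rw [Measure.map_apply hm hs, Measure.compProd_apply (hm hs)]
      conv_rhs => rw [← (α M).disintegrate (α M).condKernel, Measure.compProd_apply hs,
        Measure.fst, h1, ← hlaw M le_rfl]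
      rw [lintegral_map (Kernel.measurable_kernel_prodMk_left hs) (hY M)]
      rfl
    refine ⟨Ω × X, inferInstance, P ⊗ₘ κ, Y', inferInstance, hY', ?_, ?_⟩
    · intro i hi
      rcases Nat.lt_or_ge M i with h | h
      · obtain rfl : i = M + 1 := by omega
        have hm : Measurable fun p : Ω × X => (Y M p.1, p.2) :=
          ((hY M).comp measurable_fst).prodMk measurable_snd
        rw [← h2, ← hnew, Measure.map_map measurable_snd hm]
        congr 1
        funext p; simp [Y']
      · conv_rhs => rw [← hlaw i h, ← Measure.fst_compProd P κ, Measure.fst,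
          Measure.map_map (hY i) measurable_fst]
        congr 1
        funext p; simp [Y', h]
    · intro i hi
      rcases Nat.lt_or_ge i M with h | h
      · rw [← hpair i h, ← hold _ ((hY i).prodMk (hY (i + 1)))]
        congr 1
        funext p; simp [Y', h.le, Nat.succ_le_of_lt h]
      · obtain rfl : i = M := by omega
        rw [← hnew]
        congr 1
        funext p; simp [Y']

end Gluing


/-! ### Discretized densities and their plans -/

section Smear

variable {X : Type*} [MeasurableSpace X] {m : Measure X} {χ : ℕ → X → ℝ} {J : ℕ}

/-- The density which gives mass `w j` to the `j`-th member of the family `χ`, distributed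
proportionally to `χ j`. A weight on a member of zero mass is lost. -/
noncomputable def smear (m : Measure X) (χ : ℕ → X → ℝ) (J : ℕ) (w : ℕ → ℝ) (x : X) : ℝ :=
  ∑ j ∈ Finset.range J, w j / (∫ a, χ j a ∂m) * χ j x

lemma smear_nonneg (hχ0 : ∀ j x, 0 ≤ χ j x) {w : ℕ → ℝ} (hw : ∀ j, 0 ≤ w j) (x : X) :
    0 ≤ smear m χ J w x :=
  Finset.sum_nonneg fun j _ =>
    mul_nonneg (div_nonneg (hw j) (integral_nonneg (hχ0 j))) (hχ0 j x)

lemma measurable_smear (hχm : ∀ j, Measurable (χ j)) (w : ℕ → ℝ) :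
    Measurable (smear m χ J w) := by
  unfold smear
  exact Finset.measurable_fun_sum _ fun j _ => (hχm j).const_mul _

lemma densityMeasure_smear (hχ0 : ∀ j x, 0 ≤ χ j x) (hχm : ∀ j, Measurable (χ j))
    {w : ℕ → ℝ} (hw : ∀ j, 0 ≤ w j) :
    densityMeasure m (smear m χ J w) =
      ∑ j ∈ Finset.range J,
        ENNReal.ofReal (w j / ∫ a, χ j a ∂m) • densityMeasure m (χ j) := by
  have hc : ∀ j, 0 ≤ w j / ∫ a, χ j a ∂m := fun j => div_nonneg (hw j) (integral_nonneg (hχ0 j))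
  ext s hs
  simp only [Measure.finsetSum_apply, Measure.smul_apply, smul_eq_mul, densityMeasure,
    withDensity_apply _ hs]
  simp_rw [← lintegral_const_mul _ (hχm _).ennreal_ofReal]
  rw [← lintegral_finsetSum _ fun j _ => (hχm j).ennreal_ofReal.const_mul _]
  refine lintegral_congr fun x => ?_
  rw [smear, ENNReal.ofReal_sum_of_nonneg fun j _ => mul_nonneg (hc j) (hχ0 j x)]
  exact Finset.sum_congr rfl fun j _ => ENNReal.ofReal_mul (hc j)

lemma densityMeasure_univ {f : X → ℝ} (h0 : ∀ x, 0 ≤ f x) (hi : Integrable f m) :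
    densityMeasure m f Set.univ = ENNReal.ofReal (∫ a, f a ∂m) := by
  rw [densityMeasure, withDensity_apply _ .univ, setLIntegral_univ,
    ofReal_integral_eq_lintegral_ofReal hi (ae_of_all _ h0)]

/-- The plan with weights `a j k` on the products of the normalized members of `χ`. -/
noncomputable def smearPlan (m : Measure X) (χ : ℕ → X → ℝ) (J : ℕ) (a : ℕ → ℕ → ℝ) :
    Measure (X × X) :=
  ∑ j ∈ Finset.range J, ∑ k ∈ Finset.range J,
    ENNReal.ofReal (a j k / ((∫ x, χ j x ∂m) * ∫ x, χ k x ∂m)) •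
      (densityMeasure m (χ j)).prod (densityMeasure m (χ k))

lemma smearPlan_mem_adm (hχ0 : ∀ j x, 0 ≤ χ j x) (hχm : ∀ j, Measurable (χ j))
    (hχi : ∀ j, Integrable (χ j) m) {w w' : ℕ → ℝ} {a : ℕ → ℕ → ℝ}
    (ha : ∀ j k, 0 ≤ a j k) (hw0 : ∀ j, 0 ≤ w j) (hw0' : ∀ j, 0 ≤ w' j)
    (hw : ∀ j < J, ∑ k ∈ Finset.range J, a j k = w j)
    (hw' : ∀ k < J, ∑ j ∈ Finset.range J, a j k = w' k)
    (hpos : ∀ j k, a j k ≠ 0 → ∫ x, χ j x ∂m ≠ 0 ∧ ∫ x, χ k x ∂m ≠ 0) :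
    smearPlan m χ J a ∈
      Adm (densityMeasure m (smear m χ J w)) (densityMeasure m (smear m χ J w')) := by
  have hfin : ∀ j, IsFiniteMeasure (densityMeasure m (χ j)) := fun j =>
    ⟨by rw [densityMeasure_univ (hχ0 j) (hχi j)]; exact ENNReal.ofReal_lt_top⟩
  have hI : ∀ j, 0 ≤ ∫ x, χ j x ∂m := fun j => integral_nonneg (hχ0 j)
  have hmass : ∀ j k, a j k / ((∫ x, χ j x ∂m) * ∫ x, χ k x ∂m) * (∫ x, χ k x ∂m) =
      a j k / ∫ x, χ j x ∂m := by
    intro j k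
    by_cases h : a j k = 0
    · simp [h]
    · obtain ⟨h1, h2⟩ := hpos j k h
      field_simp
  have hmass' : ∀ j k, a j k / ((∫ x, χ j x ∂m) * ∫ x, χ k x ∂m) * (∫ x, χ j x ∂m) =
      a j k / ∫ x, χ k x ∂m := by
    intro j k
    by_cases h : a j k = 0
    · simp [h]
    · obtain ⟨h1, h2⟩ := hpos j k h
      field_simp
  constructor
  · rw [smearPlan, Measure.map_finset_sum measurable_fst.aemeasurable,
      densityMeasure_smear hχ0 hχm hw0]
    refine Finset.sum_congr rfl fun j hj => ?_
    rw [Measure.map_finset_sum measurable_fst.aemeasurable]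
    simp_rw [Measure.map_smul, Measure.map_fst_prod, densityMeasure_univ (hχ0 _) (hχi _), smul_smul]
    rw [← Finset.sum_smul, ← hw j (Finset.mem_range.1 hj), Finset.sum_div,
      ENNReal.ofReal_sum_of_nonneg fun k _ => div_nonneg (ha j k) (hI j)]
    congr 1
    refine Finset.sum_congr rfl fun k _ => ?_
    rw [← ENNReal.ofReal_mul (div_nonneg (ha j k) (mul_nonneg (hI j) (hI k))), hmass]
  · rw [smearPlan, Finset.sum_comm, Measure.map_finset_sum measurable_snd.aemeasurable,
      densityMeasure_smear hχ0 hχm hw0']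
    refine Finset.sum_congr rfl fun k hk => ?_
    rw [Measure.map_finset_sum measurable_snd.aemeasurable]
    simp_rw [Measure.map_smul, Measure.map_snd_prod, densityMeasure_univ (hχ0 _) (hχi _), smul_smul]
    rw [← Finset.sum_smul, ← hw' k (Finset.mem_range.1 hk), Finset.sum_div,
      ENNReal.ofReal_sum_of_nonneg fun j _ => div_nonneg (ha j k) (hI k)]
    congr 1
    refine Finset.sum_congr rfl fun j _ => ?_
    rw [← ENNReal.ofReal_mul (div_nonneg (ha j k) (mul_nonneg (hI j) (hI k))), hmass']

/-- If the weights `a j k` only join members of `χ` whose points are at distance at most `D`, then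
the discretized densities are at `∞`-Wasserstein distance at most `D`. -/
lemma Winf_smear_le {X : Type*} [MetricSpace X] [MeasurableSpace X] {m : Measure X}
    {χ : ℕ → X → ℝ} {J : ℕ} (hχ0 : ∀ j x, 0 ≤ χ j x) (hχm : ∀ j, Measurable (χ j))
    (hχi : ∀ j, Integrable (χ j) m) {w w' : ℕ → ℝ} {a : ℕ → ℕ → ℝ}
    (ha : ∀ j k, 0 ≤ a j k) (hw0 : ∀ j, 0 ≤ w j) (hw0' : ∀ j, 0 ≤ w' j)
    (hw : ∀ j < J, ∑ k ∈ Finset.range J, a j k = w j)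
    (hw' : ∀ k < J, ∑ j ∈ Finset.range J, a j k = w' k)
    (hpos : ∀ j k, a j k ≠ 0 → ∫ x, χ j x ∂m ≠ 0 ∧ ∫ x, χ k x ∂m ≠ 0) {D : ℝ≥0∞}
    (hD : ∀ j k, a j k ≠ 0 → ∀ x y, χ j x ≠ 0 → χ k y ≠ 0 → edist x y ≤ D) :
    Winf (densityMeasure m (smear m χ J w)) (densityMeasure m (smear m χ J w')) ≤ D := by
  have hfin : ∀ j, IsFiniteMeasure (densityMeasure m (χ j)) := fun j =>
    ⟨by rw [densityMeasure_univ (hχ0 j) (hχi j)]; exact ENNReal.ofReal_lt_top⟩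
  have hae : ∀ j, ∀ᵐ x ∂densityMeasure m (χ j), χ j x ≠ 0 := fun j => by
    rw [densityMeasure, ae_withDensity_iff (hχm j).ennreal_ofReal]
    filter_upwards with x hx h
    simp [h] at hx
  refine (iInf₂_le _ (smearPlan_mem_adm hχ0 hχm hχi ha hw0 hw0' hw hw' hpos)).trans ?_
  rw [eLpNorm_exponent_top]
  refine essSup_le_of_ae_le _ ?_
  unfold smearPlan
  refine ae_finsetSum_measure_iff.2 fun j _ => ae_finsetSum_measure_iff.2 fun k _ => ?_
  by_cases h : a j k = 0
  · simp [h]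
  · refine Measure.ae_smul_measure ?_ _
    have h1 : ∀ᵐ p ∂(densityMeasure m (χ j)).prod (densityMeasure m (χ k)), χ j p.1 ≠ 0 :=
      Measure.quasiMeasurePreserving_fst.ae (hae j)
    have h2 : ∀ᵐ p ∂(densityMeasure m (χ j)).prod (densityMeasure m (χ k)), χ k p.2 ≠ 0 :=
      Measure.quasiMeasurePreserving_snd.ae (hae k)
    filter_upwards [h1, h2] with p hp1 hp2
    have := hD j k h p.1 p.2 hp1 hp2
    rwa [edist_dist, ← Real.enorm_of_nonneg dist_nonneg] at this

end Smear


/-! ### Weights read off from a chain of random variables -/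

section Weights

variable {Ω X : Type*} [MeasurableSpace Ω] {P : Measure Ω}
  {E : Set Ω} {Y : ℕ → Ω → X} {χ : ℕ → X → ℝ} {J M : ℕ}

/-- The conditional expectation of `χ j (Y i)` given the event `E`. -/
noncomputable def weight (P : Measure Ω) (E : Set Ω) (Y : ℕ → Ω → X) (χ : ℕ → X → ℝ)
    (i j : ℕ) : ℝ :=
  (P.real E)⁻¹ * ∫ ω in E, χ j (Y i ω) ∂P

/-- The conditional expectation of `χ j (Y i) * χ k (Y (i + 1))` given the event `E`. -/
noncomputable def pairWeight (P : Measure Ω) (E : Set Ω) (Y : ℕ → Ω → X) (χ : ℕ → X → ℝ)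
    (i j k : ℕ) : ℝ :=
  (P.real E)⁻¹ * ∫ ω in E, χ j (Y i ω) * χ k (Y (i + 1) ω) ∂P

lemma weight_nonneg (hχ0 : ∀ j x, 0 ≤ χ j x) (i j : ℕ) : 0 ≤ weight P E Y χ i j :=
  mul_nonneg (inv_nonneg.2 measureReal_nonneg) (integral_nonneg fun _ => hχ0 _ _)

lemma pairWeight_nonneg (hχ0 : ∀ j x, 0 ≤ χ j x) (i j k : ℕ) : 0 ≤ pairWeight P E Y χ i j k :=
  mul_nonneg (inv_nonneg.2 measureReal_nonneg)
    (integral_nonneg fun _ => mul_nonneg (hχ0 _ _) (hχ0 _ _))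

lemma exists_of_pairWeight_ne_zero {i j k : ℕ} (h : pairWeight P E Y χ i j k ≠ 0)
    {Q : X → X → Prop} (hQ : ∀ᵐ ω ∂P, Q (Y i ω) (Y (i + 1) ω)) :
    ∃ x y, χ j x ≠ 0 ∧ χ k y ≠ 0 ∧ Q x y := by
  by_contra! hcon
  apply h
  rw [pairWeight, integral_eq_zero_of_ae, mul_zero]
  refine ae_restrict_of_ae ?_
  filter_upwards [hQ] with ω hω
  by_contra! hne
  exact hcon _ _ (left_ne_zero_of_mul hne) (right_ne_zero_of_mul hne) hω

variable [MeasurableSpace X] [IsProbabilityMeasure P]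

lemma integrable_of_mem_Icc {f : Ω → ℝ} (hf : Measurable f) (h0 : ∀ ω, 0 ≤ f ω)
    (h1 : ∀ ω, f ω ≤ 1) (E : Set Ω) : Integrable f (P.restrict E) :=
  Integrable.of_bound hf.aestronglyMeasurable 1
    (ae_of_all _ fun ω => by rw [Real.norm_of_nonneg (h0 ω)]; exact h1 ω)

lemma sum_weight (hχ0 : ∀ j x, 0 ≤ χ j x) (hχ1 : ∀ j x, χ j x ≤ 1) (hχm : ∀ j, Measurable (χ j))
    (hY : ∀ i, Measurable (Y i)) (hE : MeasurableSet E) (hp : P.real E ≠ 0) {i : ℕ}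
    (h : ∀ ω ∈ E, ∑ j ∈ Finset.range J, χ j (Y i ω) = 1) :
    ∑ j ∈ Finset.range J, weight P E Y χ i j = 1 := by
  simp_rw [weight, ← Finset.mul_sum]
  have hi : ∀ j, Integrable (fun ω => χ j (Y i ω)) (P.restrict E) := fun j =>
    integrable_of_mem_Icc ((hχm j).comp (hY i)) (fun ω => hχ0 _ _) (fun ω => hχ1 _ _) E
  rw [← integral_finsetSum _ fun j _ => hi j, setIntegral_congr_fun hE h]
  simp [hp]

lemma integrable_pair (hχ0 : ∀ j x, 0 ≤ χ j x) (hχ1 : ∀ j x, χ j x ≤ 1)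
    (hχm : ∀ j, Measurable (χ j)) (hY : ∀ i, Measurable (Y i)) (E : Set Ω) (i j k : ℕ) :
    Integrable (fun ω => χ j (Y i ω) * χ k (Y (i + 1) ω)) (P.restrict E) :=
  integrable_of_mem_Icc (((hχm j).comp (hY i)).mul ((hχm k).comp (hY (i + 1))))
    (fun _ => mul_nonneg (hχ0 _ _) (hχ0 _ _))
    (fun _ => mul_le_one₀ (hχ1 _ _) (hχ0 _ _) (hχ1 _ _)) E

lemma sum_pairWeight_right (hχ0 : ∀ j x, 0 ≤ χ j x) (hχ1 : ∀ j x, χ j x ≤ 1)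
    (hχm : ∀ j, Measurable (χ j)) (hY : ∀ i, Measurable (Y i)) (hE : MeasurableSet E) {i : ℕ}
    (h : ∀ ω ∈ E, ∑ j ∈ Finset.range J, χ j (Y (i + 1) ω) = 1) (j : ℕ) :
    ∑ k ∈ Finset.range J, pairWeight P E Y χ i j k = weight P E Y χ i j := by
  simp_rw [weight, pairWeight, ← Finset.mul_sum]
  rw [← integral_finsetSum _ fun k _ => integrable_pair hχ0 hχ1 hχm hY E i j k]
  congr 1
  refine setIntegral_congr_fun hE fun ω hω => ?_
  simp only [← Finset.mul_sum, h ω hω, mul_one]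

lemma sum_pairWeight_left (hχ0 : ∀ j x, 0 ≤ χ j x) (hχ1 : ∀ j x, χ j x ≤ 1)
    (hχm : ∀ j, Measurable (χ j)) (hY : ∀ i, Measurable (Y i)) (hE : MeasurableSet E) {i : ℕ}
    (h : ∀ ω ∈ E, ∑ j ∈ Finset.range J, χ j (Y i ω) = 1) (k : ℕ) :
    ∑ j ∈ Finset.range J, pairWeight P E Y χ i j k = weight P E Y χ (i + 1) k := by
  simp_rw [weight, pairWeight, ← Finset.mul_sum]
  rw [← integral_finsetSum _ fun j _ => integrable_pair hχ0 hχ1 hχm hY E i j k]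
  congr 1
  refine setIntegral_congr_fun hE fun ω hω => ?_
  simp only [← Finset.sum_mul, h ω hω, one_mul]

lemma weight_le (hχ0 : ∀ j x, 0 ≤ χ j x) (hχ1 : ∀ j x, χ j x ≤ 1) (hχm : ∀ j, Measurable (χ j))
    (hY : ∀ i, Measurable (Y i)) (i j : ℕ) :
    weight P E Y χ i j ≤ (P.real E)⁻¹ * ∫ x, χ j x ∂(P.map (Y i)) := by
  have hi : Integrable (fun ω => χ j (Y i ω)) P := by
    rw [← Measure.restrict_univ (μ := P)]
    exact integrable_of_mem_Icc ((hχm j).comp (hY i)) (fun ω => hχ0 _ _) (fun ω => hχ1 _ _) _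
  rw [integral_map (hY i).aemeasurable (hχm j).aestronglyMeasurable, weight]
  exact mul_le_mul_of_nonneg_left
    (setIntegral_le_integral hi (ae_of_all _ fun ω => hχ0 _ _)) (inv_nonneg.2 measureReal_nonneg)

lemma le_sum_integral_map (hχ0 : ∀ j x, 0 ≤ χ j x) (hχ1 : ∀ j x, χ j x ≤ 1)
    (hχm : ∀ j, Measurable (χ j)) (hY : ∀ i, Measurable (Y i)) (hE : MeasurableSet E)
    (hp : P.real E ≠ 0) {i : ℕ} (h : ∀ ω ∈ E, ∑ j ∈ Finset.range J, χ j (Y i ω) = 1) :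
    P.real E ≤ ∑ j ∈ Finset.range J, ∫ x, χ j x ∂(P.map (Y i)) := by
  have h1 := Finset.sum_le_sum (s := Finset.range J)
    fun j _ => weight_le (P := P) (E := E) hχ0 hχ1 hχm hY i j
  rw [sum_weight hχ0 hχ1 hχm hY hE hp h, ← Finset.mul_sum] at h1
  rwa [inv_mul_eq_div, one_le_div (lt_of_le_of_ne measureReal_nonneg hp.symm)] at h1

/-- Conditioning on an event of probability `p` changes the masses of the members of a partition
by at most `2 * (1 - p)` in total. -/
lemma sum_abs_weight_sub_le (hχ0 : ∀ j x, 0 ≤ χ j x) (hχ1 : ∀ j x, χ j x ≤ 1)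
    (hχs : ∀ x, ∑ j ∈ Finset.range J, χ j x ≤ 1)
    (hχm : ∀ j, Measurable (χ j)) (hY : ∀ i, Measurable (Y i)) (hE : MeasurableSet E)
    (hp : P.real E ≠ 0) {i : ℕ} (h : ∀ ω ∈ E, ∑ j ∈ Finset.range J, χ j (Y i ω) = 1) :
    ∑ j ∈ Finset.range J, |weight P E Y χ i j - ∫ x, χ j x ∂(P.map (Y i))| ≤
      2 * (1 - P.real E) := by
  set p := P.real E with hpdef
  have hp0 : 0 < p := lt_of_le_of_ne measureReal_nonneg hp.symm
  have hp1 : p ≤ 1 := measureReal_le_one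
  have hi : ∀ j, Integrable (χ j) (P.map (Y i)) := fun j =>
    have := Measure.isProbabilityMeasure_map (μ := P) (hY i).aemeasurable
    Integrable.of_bound (hχm j).aestronglyMeasurable 1
      (ae_of_all _ fun x => by rw [Real.norm_of_nonneg (hχ0 j x)]; exact hχ1 j x)
  have hT : ∑ j ∈ Finset.range J, ∫ x, χ j x ∂(P.map (Y i)) ≤ 1 := by
    have := Measure.isProbabilityMeasure_map (μ := P) (hY i).aemeasurable
    rw [← integral_finsetSum _ fun j _ => hi j]
    calc _ ≤ ∫ x, (1 : ℝ) ∂(P.map (Y i)) :=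
          integral_mono (integrable_finsetSum _ fun j _ => hi j) (integrable_const _) hχs
      _ = 1 := by simp
  have hS := sum_weight hχ0 hχ1 hχm hY hE hp h
  -- With `u = p * weight ≤ t`, both `weight - u` and `t - u` are nonnegative.
  have hterm : ∀ j, |weight P E Y χ i j - ∫ x, χ j x ∂(P.map (Y i))| ≤
      (1 - 2 * p) * weight P E Y χ i j + ∫ x, χ j x ∂(P.map (Y i)) := by
    intro j
    have h1 := weight_le (P := P) (E := E) hχ0 hχ1 hχm hY i j
    have h2 := weight_nonneg (P := P) (E := E) (Y := Y) hχ0 i j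
    rw [← hpdef, inv_mul_eq_div, le_div_iff₀ hp0] at h1
    rw [abs_le]
    constructor
    · nlinarith
    · nlinarith
  calc _ ≤ ∑ j ∈ Finset.range J,
        ((1 - 2 * p) * weight P E Y χ i j + ∫ x, χ j x ∂(P.map (Y i))) :=
        Finset.sum_le_sum fun j _ => hterm j
    _ ≤ 2 * (1 - p) := by
      rw [Finset.sum_add_distrib, ← Finset.mul_sum, hS]; linarith

end Weights

/-! ### The `L¹` estimate for discretized densities -/

section L1

variable {X X' : Type*} [MeasurableSpace X] [MeasurableSpace X'] {m : Measure X} {m' : Measure X'}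
  {χ : ℕ → X → ℝ} {χ' : ℕ → X' → ℝ} {J : ℕ} {w v : ℕ → ℝ} {g : X → ℝ} {g' ρ : X' → ℝ} {κ : ℝ}

/-- Where `χ j ≠ 0`, the function `g` may be replaced by the constant `v j` at the cost of `κ`. -/
lemma integral_mul_abs_sub_le (hχ0 : ∀ j x, 0 ≤ χ j x) (hχi : ∀ j, Integrable (χ j) m)
    (hv : ∀ j x, χ j x ≠ 0 → |g x - v j| ≤ κ) {f : X → ℝ} {j : ℕ}
    (hf : Integrable (fun x => χ j x * f x) m) (c : ℝ) (hfc : ∀ x, f x ≤ c + |g x - v j|) :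
    ∫ x, χ j x * f x ∂m ≤ (∫ x, χ j x ∂m) * (c + κ) := by
  rw [← integral_mul_const]
  refine integral_mono hf ((hχi j).mul_const _) fun x => ?_
  by_cases h : χ j x = 0
  · simp [h]
  · exact mul_le_mul_of_nonneg_left ((hfc x).trans (by linarith [hv j x h])) (hχ0 j x)

lemma integrable_chi_mul (hχ0 : ∀ j x, 0 ≤ χ j x) (hχ1 : ∀ j x, χ j x ≤ 1)
    (hχm : ∀ j, Measurable (χ j)) {f : X → ℝ} (hf : Integrable f m) (j : ℕ) :
    Integrable (fun x => χ j x * f x) m :=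
  hf.bdd_mul (c := 1) (hχm j).aestronglyMeasurable
    (ae_of_all _ fun x => by rw [Real.norm_of_nonneg (hχ0 j x)]; exact hχ1 j x)

/-- Comparison of a discretized density with a function which is almost equal to `v j` where
`χ j ≠ 0`. -/
lemma integral_abs_smear_sub_le (hχ0 : ∀ j x, 0 ≤ χ j x) (hχ1 : ∀ j x, χ j x ≤ 1)
    (hχs : ∀ x, ∑ j ∈ Finset.range J, χ j x ≤ 1) (hχm : ∀ j, Measurable (χ j))
    (hχi : ∀ j, Integrable (χ j) m) (hw : ∀ j < J, w j ≠ 0 → ∫ x, χ j x ∂m ≠ 0)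
    (hg : Integrable g m) (hv : ∀ j x, χ j x ≠ 0 → |g x - v j| ≤ κ) :
    ∫ x, |smear m χ J w x - g x| ∂m ≤
      ∑ j ∈ Finset.range J, |w j - (∫ x, χ j x ∂m) * v j| + ∫ x, |g x| ∂m
        - ∑ j ∈ Finset.range J, (∫ x, χ j x ∂m) * |v j|
        + 2 * κ * ∑ j ∈ Finset.range J, ∫ x, χ j x ∂m := by
  have hI : ∀ j, 0 ≤ ∫ x, χ j x ∂m := fun j => integral_nonneg (hχ0 j)
  have hint := fun f hf j => integrable_chi_mul (m := m) (f := f) hχ0 hχ1 hχm hf j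
  have hd : ∀ j, Integrable (fun x => χ j x * |w j / (∫ a, χ j a ∂m) - g x|) m := by
    intro j
    have : Integrable (fun x => χ j x * (w j / (∫ a, χ j a ∂m) - g x)) m := by
      simp_rw [mul_sub]
      exact ((hχi j).mul_const _).sub (hint g hg j)
    refine this.abs.congr (ae_of_all _ fun x => ?_)
    simp only [abs_mul, abs_of_nonneg (hχ0 j x)]
  have hpt : ∀ x, |smear m χ J w x - g x| ≤
      ∑ j ∈ Finset.range J, (χ j x * |w j / (∫ a, χ j a ∂m) - g x| - χ j x * |g x|) + |g x| := by
    intro x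
    have : smear m χ J w x - g x =
        ∑ j ∈ Finset.range J, χ j x * (w j / (∫ a, χ j a ∂m) - g x)
          - (1 - ∑ j ∈ Finset.range J, χ j x) * g x := by
      simp only [smear, mul_sub, Finset.sum_sub_distrib, sub_mul, Finset.sum_mul]
      simp only [mul_comm]
      ring
    rw [this]
    refine (abs_sub _ _).trans ?_
    rw [abs_mul, abs_of_nonneg (sub_nonneg.2 (hχs x)), Finset.sum_sub_distrib, ← Finset.sum_mul]
    have := Finset.abs_sum_le_sum_abs
      (fun j => χ j x * (w j / (∫ a, χ j a ∂m) - g x)) (Finset.range J)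
    simp only [abs_mul, abs_of_nonneg (hχ0 _ x)] at this
    linarith
  have hd' : ∀ j, Integrable
      (fun x => χ j x * |w j / (∫ a, χ j a ∂m) - g x| - χ j x * |g x|) m := fun j =>
    (hd j).sub (hint _ hg.abs j)
  have hR : Integrable (fun x => ∑ j ∈ Finset.range J,
      (χ j x * |w j / (∫ a, χ j a ∂m) - g x| - χ j x * |g x|)) m :=
    integrable_finsetSum _ fun j _ => hd' j
  have h1 : ∫ x, |smear m χ J w x - g x| ∂m ≤
      ∑ j ∈ Finset.range J, (∫ x, χ j x * |w j / (∫ a, χ j a ∂m) - g x| ∂m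
        - ∫ x, χ j x * |g x| ∂m) + ∫ x, |g x| ∂m := by
    refine (integral_mono_of_nonneg (ae_of_all _ fun x => abs_nonneg _) (hR.add hg.abs)
      (ae_of_all _ hpt)).trans_eq ?_
    rw [integral_add' hR hg.abs, integral_finsetSum _ fun j _ => hd' j]
    congr 1
    exact Finset.sum_congr rfl fun j _ => integral_sub (hd j) (hint _ hg.abs j)
  have h2 : ∀ j ∈ Finset.range J, ∫ x, χ j x * |w j / (∫ a, χ j a ∂m) - g x| ∂m
      - ∫ x, χ j x * |g x| ∂m ≤ |w j - (∫ x, χ j x ∂m) * v j| - (∫ x, χ j x ∂m) * |v j|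
        + 2 * κ * ∫ x, χ j x ∂m := by
    intro j hj
    have e1 := integral_mul_abs_sub_le hχ0 hχi hv (hd j) |w j / (∫ a, χ j a ∂m) - v j| fun x => by
      have := abs_sub_le (w j / (∫ a, χ j a ∂m)) (v j) (g x)
      rwa [abs_sub_comm (v j)] at this
    have e2 := integral_mul_abs_sub_le hχ0 hχi hv (f := fun x => - |g x|) (j := j)
      (by simpa using (hint _ hg.abs j).neg) (- |v j|) fun x => by
        have := abs_sub_abs_le_abs_sub (v j) (g x)
        rw [abs_sub_comm (v j)] at this
        linarith
    simp only [mul_neg, integral_neg] at e2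
    have e3 : (∫ x, χ j x ∂m) * |w j / (∫ a, χ j a ∂m) - v j| = |w j - (∫ x, χ j x ∂m) * v j| := by
      nth_rewrite 1 [← abs_of_nonneg (hI j)]
      rw [← abs_mul, mul_sub]
      by_cases h : ∫ x, χ j x ∂m = 0
      · have : w j = 0 := by
          by_contra hne
          exact hw j (Finset.mem_range.1 hj) hne h
        simp [this, h]
      · rw [mul_div_cancel₀ _ h]
    rw [mul_add, e3] at e1
    linarith
  have h3 := Finset.sum_le_sum h2
  rw [Finset.sum_add_distrib, Finset.sum_sub_distrib _ (fun j => (∫ x, χ j x ∂m) * |v j|),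
    ← Finset.mul_sum] at h3
  linarith

/-- The terms produced by `integral_abs_smear_sub_le` are controlled, on the space which carries
the density `ρ`, by the `L¹` distance from `ρ` to the test function. -/
lemma sum_abs_sub_mul_le (hχ0 : ∀ j x, 0 ≤ χ' j x) (hχ1 : ∀ j x, χ' j x ≤ 1)
    (hχs : ∀ x, ∑ j ∈ Finset.range J, χ' j x ≤ 1) (hχm : ∀ j, Measurable (χ' j))
    (hχi : ∀ j, Integrable (χ' j) m') (hρ : Integrable ρ m') (hρ0 : 0 ≤ᵐ[m'] ρ)
    (hg : Integrable g' m') (hv : ∀ j x, χ' j x ≠ 0 → |g' x - v j| ≤ κ) :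
    ∑ j ∈ Finset.range J, |w j - (∫ x, χ' j x ∂m') * v j| + ∫ x, |g' x| ∂m'
        - ∑ j ∈ Finset.range J, (∫ x, χ' j x ∂m') * |v j| ≤
      ∑ j ∈ Finset.range J, |w j - ∫ x, χ' j x * ρ x ∂m'| + ∫ x, |ρ x - g' x| ∂m'
        + (∫ x, ρ x ∂m' - ∑ j ∈ Finset.range J, ∫ x, χ' j x * ρ x ∂m')
        + 2 * κ * ∑ j ∈ Finset.range J, ∫ x, χ' j x ∂m' := by
  have hint := fun f hf j => integrable_chi_mul (m := m') (f := f) hχ0 hχ1 hχm hf j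
  have hI : ∀ j, 0 ≤ ∫ x, χ' j x ∂m' := fun j => integral_nonneg (hχ0 j)
  have h1 : ∀ j ∈ Finset.range J, |w j - (∫ x, χ' j x ∂m') * v j| - (∫ x, χ' j x ∂m') * |v j| ≤
      |w j - ∫ x, χ' j x * ρ x ∂m'| + ∫ x, χ' j x * |ρ x - g' x| ∂m'
        - ∫ x, χ' j x * |g' x| ∂m' + 2 * κ * ∫ x, χ' j x ∂m' := by
    intro j _
    have e1 : |∫ x, χ' j x * ρ x ∂m' - ∫ x, χ' j x * g' x ∂m'| ≤
        ∫ x, χ' j x * |ρ x - g' x| ∂m' := by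
      rw [← integral_sub (hint _ hρ j) (hint _ hg j)]
      refine (abs_integral_le_integral_abs).trans_eq (integral_congr_ae (ae_of_all _ fun x => ?_))
      simp only [← mul_sub, abs_mul, abs_of_nonneg (hχ0 j x)]
    have e2 : |∫ x, χ' j x * g' x ∂m' - (∫ x, χ' j x ∂m') * v j| ≤ (∫ x, χ' j x ∂m') * κ := by
      rw [← integral_mul_const, ← integral_sub (hint _ hg j) ((hχi j).mul_const _)]
      refine (abs_integral_le_integral_abs).trans ?_
      have : ∀ x, |χ' j x * g' x - χ' j x * v j| = χ' j x * |g' x - v j| := fun x => by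
        rw [← mul_sub, abs_mul, abs_of_nonneg (hχ0 j x)]
      simp_rw [this]
      refine (integral_mul_abs_sub_le hχ0 hχi hv ?_ 0 fun x => by simp).trans_eq (by simp)
      have h := ((hint _ hg j).sub ((hχi j).mul_const (v j))).abs
      exact h.congr (ae_of_all _ this)
    have e3 := integral_mul_abs_sub_le hχ0 hχi hv (f := fun x => |g' x|) (j := j)
      (hint _ hg.abs j) |v j| fun x => by
        have := abs_sub_abs_le_abs_sub (g' x) (v j)
        linarith
    have e4 := abs_sub_le (w j) (∫ x, χ' j x * ρ x ∂m') ((∫ x, χ' j x ∂m') * v j)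
    have e5 := abs_sub_le (∫ x, χ' j x * ρ x ∂m') (∫ x, χ' j x * g' x ∂m')
      ((∫ x, χ' j x ∂m') * v j)
    rw [mul_add] at e3
    linarith
  have h2 := Finset.sum_le_sum h1
  rw [Finset.sum_sub_distrib, Finset.sum_add_distrib, Finset.sum_sub_distrib,
    Finset.sum_add_distrib, ← Finset.mul_sum] at h2
  -- Off the partition, `|g'|` is at most `|ρ - g'| + ρ`.
  have h3 : ∫ x, |g' x| ∂m' - ∑ j ∈ Finset.range J, ∫ x, χ' j x * |g' x| ∂m' ≤
      (∫ x, |ρ x - g' x| ∂m' - ∑ j ∈ Finset.range J, ∫ x, χ' j x * |ρ x - g' x| ∂m') +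
      (∫ x, ρ x ∂m' - ∑ j ∈ Finset.range J, ∫ x, χ' j x * ρ x ∂m') := by
    have hsum : ∀ f, Integrable f m' → ∫ x, f x ∂m' - ∑ j ∈ Finset.range J, ∫ x, χ' j x * f x ∂m' =
        ∫ x, (f x - ∑ j ∈ Finset.range J, χ' j x * f x) ∂m' := fun f hf => by
      rw [integral_sub hf (integrable_finsetSum _ fun j _ => hint f hf j),
        integral_finsetSum _ fun j _ => hint f hf j]
    have hin : ∀ f, Integrable f m' →
        Integrable (fun x => f x - ∑ j ∈ Finset.range J, χ' j x * f x) m' := fun f hf =>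
      hf.sub (integrable_finsetSum _ fun j _ => hint f hf j)
    have hρg : Integrable (fun x => |ρ x - g' x|) m' := (hρ.sub hg).abs
    rw [hsum _ hg.abs, hsum _ hρ, hsum _ hρg, ← integral_add (hin _ hρg) (hin _ hρ)]
    refine integral_mono_ae (hin _ hg.abs) ((hin _ hρg).add (hin _ hρ)) ?_
    filter_upwards [hρ0] with x hx
    simp only [← Finset.sum_mul]
    have h4 : |g' x| ≤ |ρ x - g' x| + ρ x := by
      have := abs_sub_abs_le_abs_sub (g' x) (ρ x)
      rw [abs_sub_comm, abs_of_nonneg hx] at this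
      linarith
    nlinarith [hχs x]
  linarith

/-- The `L¹` distance between a discretized density and a test function `g` on one space is
controlled by the `L¹` distance between the original density `ρ` and the test function on the
other space. The error terms are the displacement of the weights `w`, the mass of `ρ` missed by the
partition, the oscillation `κ` of `g`, and the change of the masses of the partition. -/
theorem integral_abs_smear_sub_le_of_near
    (hχ0 : ∀ j x, 0 ≤ χ j x) (hχ1 : ∀ j x, χ j x ≤ 1)
    (hχs : ∀ x, ∑ j ∈ Finset.range J, χ j x ≤ 1) (hχm : ∀ j, Measurable (χ j))
    (hχi : ∀ j, Integrable (χ j) m) (hw : ∀ j < J, w j ≠ 0 → ∫ x, χ j x ∂m ≠ 0)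
    (hg : Integrable g m) (hv : ∀ j x, χ j x ≠ 0 → |g x - v j| ≤ κ)
    (hχ0' : ∀ j x, 0 ≤ χ' j x) (hχ1' : ∀ j x, χ' j x ≤ 1)
    (hχs' : ∀ x, ∑ j ∈ Finset.range J, χ' j x ≤ 1) (hχm' : ∀ j, Measurable (χ' j))
    (hχi' : ∀ j, Integrable (χ' j) m') (hρ : Integrable ρ m') (hρ0 : 0 ≤ᵐ[m'] ρ)
    (hg' : Integrable g' m') (hv' : ∀ j x, χ' j x ≠ 0 → |g' x - v j| ≤ κ)
    {K : ℝ} (hK : ∀ j, |v j| ≤ K) :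
    ∫ x, |smear m χ J w x - g x| ∂m ≤ ∫ x, |ρ x - g' x| ∂m' + (∫ x, |g x| ∂m - ∫ x, |g' x| ∂m')
      + ∑ j ∈ Finset.range J, |w j - ∫ x, χ' j x * ρ x ∂m'|
      + (∫ x, ρ x ∂m' - ∑ j ∈ Finset.range J, ∫ x, χ' j x * ρ x ∂m')
      + 2 * κ * (∑ j ∈ Finset.range J, ∫ x, χ j x ∂m + ∑ j ∈ Finset.range J, ∫ x, χ' j x ∂m')
      + 2 * K * ∑ j ∈ Finset.range J, |∫ x, χ j x ∂m - ∫ x, χ' j x ∂m'| := by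
  have h1 := integral_abs_smear_sub_le hχ0 hχ1 hχs hχm hχi hw hg hv
  have h2 := sum_abs_sub_mul_le (w := w) hχ0' hχ1' hχs' hχm' hχi' hρ hρ0 hg' hv'
  have h3 : ∀ j ∈ Finset.range J, (|w j - (∫ x, χ j x ∂m) * v j| - (∫ x, χ j x ∂m) * |v j|) -
      (|w j - (∫ x, χ' j x ∂m') * v j| - (∫ x, χ' j x ∂m') * |v j|) ≤
      2 * K * |∫ x, χ j x ∂m - ∫ x, χ' j x ∂m'| := by
    intro j _
    set a := ∫ x, χ j x ∂m
    set b := ∫ x, χ' j x ∂m'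
    have e1 : |w j - a * v j| - |w j - b * v j| ≤ |a - b| * |v j| := by
      refine (abs_sub_abs_le_abs_sub _ _).trans_eq ?_
      rw [← abs_mul, abs_sub_comm]; congr 1; ring
    have e2 : b * |v j| - a * |v j| ≤ |a - b| * |v j| := by
      rw [← sub_mul]
      exact mul_le_mul_of_nonneg_right (by rw [abs_sub_comm]; exact le_abs_self _) (abs_nonneg _)
    nlinarith [hK j, abs_nonneg (a - b)]
  have h4 := Finset.sum_le_sum h3
  rw [Finset.sum_sub_distrib, Finset.sum_sub_distrib, Finset.sum_sub_distrib, ← Finset.mul_sum]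
    at h4
  linarith

end L1


/-! ### Test functions -/

/-- Bounded continuous functions with bounded support, as plain functions. The support is located
with respect to an arbitrary point. -/
structure IsTest {Z : Type*} [MetricSpace Z] (f : Z → ℝ) : Prop where
  continuous : Continuous f
  bounded : ∃ K, ∀ x, |f x| ≤ K
  support : ∀ z, ∃ R, ∀ x, f x ≠ 0 → dist x z ≤ R

section Test

variable {Z : Type*} [MetricSpace Z] {f g : Z → ℝ}

lemma IsTest.of_le (hf : Continuous f) {K R : ℝ} (hK : ∀ x, |f x| ≤ K) (z : Z)
    (hR : ∀ x, f x ≠ 0 → dist x z ≤ R) : IsTest f :=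
  ⟨hf, ⟨K, hK⟩, fun z' => ⟨R + dist z z', fun x hx =>
    (dist_triangle x z z').trans (by linarith [hR x hx])⟩⟩

lemma IsTest.of_mem_Cbs {φ : Z →ᵇ ℝ} (hφ : φ ∈ Cbs Z) : IsTest φ := by
  refine ⟨φ.continuous, ⟨‖φ‖, φ.norm_coe_le_norm⟩, fun z => ?_⟩
  obtain ⟨R, hR⟩ := (Metric.isBounded_iff_subset_closedBall z).1 hφ
  exact ⟨R, fun x hx => hR (subset_tsupport _ hx)⟩

lemma IsTest.abs (hf : IsTest f) : IsTest fun x => |f x| := by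
  obtain ⟨K, hK⟩ := hf.bounded
  refine ⟨hf.continuous.abs, ⟨K, fun x => by rw [abs_abs]; exact hK x⟩, fun z => ?_⟩
  obtain ⟨R, hR⟩ := hf.support z
  exact ⟨R, fun x hx => hR x (abs_ne_zero.1 hx)⟩

lemma IsTest.mul (hf : IsTest f) (hg : Continuous g) {K : ℝ} (hK : ∀ x, |g x| ≤ K) :
    IsTest fun x => f x * g x := by
  obtain ⟨K', hK'⟩ := hf.bounded
  refine ⟨hf.continuous.mul hg, ⟨K' * K, fun x => ?_⟩, fun z => ?_⟩
  · rw [abs_mul]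
    exact mul_le_mul (hK' x) (hK x) (abs_nonneg _) ((abs_nonneg _).trans (hK' x))
  · obtain ⟨R, hR⟩ := hf.support z
    exact ⟨R, fun x hx => hR x (left_ne_zero_of_mul hx)⟩

/-- A cutoff function which equals `1` on a given ball. -/
lemma exists_isTest_eq_one (z : Z) (R : ℝ) :
    ∃ f : Z → ℝ, IsTest f ∧ ∀ x, dist x z ≤ R → f x = 1 := by
  refine ⟨fun x => max 0 (min 1 (R + 1 - dist x z)),
    IsTest.of_le (by fun_prop) (K := 1) (R := R + 1) (fun x => ?_) z fun x hx => ?_, fun x hx => ?_⟩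
  · rw [abs_of_nonneg (le_max_left _ _)]
    exact max_le zero_le_one (min_le_left _ _)
  · by_contra! h
    exact hx (max_eq_left ((min_le_right _ _).trans (by linarith)))
  · have h : (1 : ℝ) ≤ R + 1 - dist x z := by linarith
    simp only [min_eq_left h, max_eq_right zero_le_one]

lemma IsTest.exists_mem_Cbs (hf : IsTest f) : ∃ φ ∈ Cbs Z, (φ : Z → ℝ) = f := by
  obtain ⟨K, hK⟩ := hf.bounded
  refine ⟨BoundedContinuousFunction.ofNormedAddCommGroup f hf.continuous K hK, ?_, rfl⟩
  rcases isEmpty_or_nonempty Z with h | ⟨⟨z⟩⟩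
  · exact (Set.toFinite _).isBounded
  · obtain ⟨R, hR⟩ := hf.support z
    exact Metric.isBounded_closedBall.subset
      (closure_minimal (fun x hx => hR x hx) (Metric.isClosed_closedBall (x := z) (ε := R)))

end Test

lemma BoundedlyFinite.lt_top_preimage_closedBall {X Z : Type*} [MetricSpace X] [MeasurableSpace X]
    [MetricSpace Z] {m : Measure X} (hm : BoundedlyFinite m) {ι : X → Z} (hι : Isometry ι)
    (z : Z) (R : ℝ) : m (ι ⁻¹' Metric.closedBall z R) < ∞ := by
  refine hm _ ?_
  rw [Metric.isBounded_iff]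
  refine ⟨R + R, fun x hx y hy => ?_⟩
  rw [← hι.dist_eq]
  exact (dist_triangle_right _ _ z).trans (add_le_add hx hy)

/-- A bounded measurable function vanishing almost everywhere off a bounded set is integrable. -/
lemma BoundedlyFinite.integrable {X Z : Type*} [MetricSpace X] [MeasurableSpace X] [BorelSpace X]
    [MetricSpace Z] {m : Measure X} (hm : BoundedlyFinite m) {ι : X → Z} (hι : Isometry ι)
    {f : X → ℝ} (hf : AEStronglyMeasurable f m) {K R : ℝ} (hK : ∀ᵐ x ∂m, |f x| ≤ K) (z : Z)
    (hR : ∀ᵐ x ∂m, f x ≠ 0 → dist (ι x) z ≤ R) : Integrable f m := by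
  have hS : MeasurableSet (ι ⁻¹' Metric.closedBall z R) :=
    (Metric.isClosed_closedBall.preimage hι.continuous).measurableSet
  have h1 : IntegrableOn f (ι ⁻¹' Metric.closedBall z R) m :=
    Measure.integrableOn_of_bounded (M := K) (hm.lt_top_preimage_closedBall hι z R).ne hf
      (ae_restrict_of_ae hK)
  rw [← integrable_indicator_iff hS] at h1
  refine h1.congr ?_
  filter_upwards [hR] with x hx
  by_cases h : f x = 0
  · simp [h]
  · exact Set.indicator_of_mem (s := ι ⁻¹' Metric.closedBall z R) (hx h) f

lemma IsTest.integrable {X Z : Type*} [MetricSpace X] [MeasurableSpace X] [BorelSpace X]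
    [MetricSpace Z] {m : Measure X} (hm : BoundedlyFinite m) {ι : X → Z} (hι : Isometry ι)
    {f : Z → ℝ} (hf : IsTest f) : Integrable (fun x => f (ι x)) m := by
  rcases isEmpty_or_nonempty X with h | ⟨⟨x⟩⟩
  · simp [Measure.eq_zero_of_isEmpty]
  · obtain ⟨K, hK⟩ := hf.bounded
    obtain ⟨R, hR⟩ := hf.support (ι x)
    exact hm.integrable hι (hf.continuous.comp hι.continuous).measurable.aestronglyMeasurable
      (ae_of_all _ fun x => hK (ι x)) (ι x) (ae_of_all _ fun x => hR (ι x))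

lemma IsRealization.tendsto_test {X : ℕ → Type*} {Xinf Z : Type*}
    [∀ n, MetricSpace (X n)] [∀ n, MeasurableSpace (X n)] [∀ n, BorelSpace (X n)]
    [MetricSpace Xinf] [MeasurableSpace Xinf] [BorelSpace Xinf]
    [MetricSpace Z] [MeasurableSpace Z] [BorelSpace Z]
    {m : ∀ n, Measure (X n)} {x : ∀ n, X n} {minf : Measure Xinf} {xinf : Xinf}
    {ι : ∀ n, X n → Z} {ιinf : Xinf → Z} (hreal : IsRealization m x minf xinf ι ιinf)
    {f : Z → ℝ} (hf : IsTest f) :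
    Tendsto (fun n => ∫ a, f (ι n a) ∂(m n)) atTop (𝓝 (∫ a, f (ιinf a) ∂minf)) := by
  obtain ⟨φ, hφ, rfl⟩ := hf.exists_mem_Cbs
  have h := hreal.tendsto_measure φ hφ
  rw [integral_map hreal.isometry_inf.continuous.measurable.aemeasurable
    φ.continuous.measurable.aestronglyMeasurable] at h
  refine h.congr fun n => ?_
  rw [integral_map (hreal.isometry n).continuous.measurable.aemeasurable
    φ.continuous.measurable.aestronglyMeasurable]

/-! ### Density of Lipschitz functions -/

section Density

variable {X Z : Type*} [MetricSpace X] [MeasurableSpace X] [BorelSpace X] [MetricSpace Z]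
  {ι : X → Z}

/-- Indicators are approximated by thickened indicators of closed subsets, which are Lipschitz on
the ambient space. -/
lemma exists_lipschitz_eLpNorm_sub_indicator_le (hι : Isometry ι) (μ : Measure X)
    [IsFiniteMeasure μ] (c : ℝ) {s : Set X} (hs : MeasurableSet s) {ε : ℝ≥0∞} (hε : ε ≠ 0) :
    ∃ g : X → ℝ, eLpNorm (g - s.indicator fun _ => c) 1 μ ≤ ε ∧
      ∃ (G : Z → ℝ) (K : NNReal), LipschitzWith K G ∧ g = G ∘ ι := by
  -- the loss allowed for each of the two sets on which the functions may differ
  obtain ⟨η, hη, hηε⟩ : ∃ η : ℝ≥0∞, η ≠ 0 ∧ ‖c‖ₑ * (η + η) ≤ ε := by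
    rcases eq_or_ne ε ∞ with rfl | hεt
    · exact ⟨1, one_ne_zero, le_top⟩
    refine ⟨ε / 2 / (‖c‖ₑ + 1), ENNReal.div_ne_zero.2 ⟨by simp [hε], by simp⟩, ?_⟩
    rw [← ENNReal.add_div, ENNReal.add_halves, mul_comm]
    calc ε / (‖c‖ₑ + 1) * ‖c‖ₑ ≤ ε / (‖c‖ₑ + 1) * (‖c‖ₑ + 1) := by gcongr; simp
      _ = ε := ENNReal.div_mul_cancel (by simp) (by simp)
  obtain ⟨F, hFs, hF, hFη⟩ := hs.exists_isClosed_sdiff_lt (measure_ne_top μ s) hη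
  obtain ⟨δ, hδ, hδη⟩ : ∃ δ : ℝ, 0 < δ ∧ μ (Metric.thickening δ F) ≤ μ F + η := by
    have h := tendsto_measure_thickening_of_isClosed (μ := μ) ⟨1, one_pos, measure_ne_top _ _⟩ hF
    have h2 := h.eventually (gt_mem_nhds (ENNReal.lt_add_right (measure_ne_top μ F) hη))
    obtain ⟨δ, h3, h4⟩ := (h2.and self_mem_nhdsWithin).exists
    exact ⟨δ, h4, h3.le⟩
  have hbad : μ (Metric.thickening δ F \ F) ≤ η := by
    rw [measure_sdiff (Metric.self_subset_thickening hδ F) hF.nullMeasurableSet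
      (measure_ne_top _ _)]
    exact tsub_le_iff_left.2 hδη
  refine ⟨fun x => c * (thickenedIndicator hδ (ι '' F) (ι x) : ℝ), ?_,
    fun y => c * (thickenedIndicator hδ (ι '' F) y : ℝ), _,
    (lipschitzWith_smul c).comp
      (NNReal.isometry_coe.lipschitz.comp (lipschitzWith_thickenedIndicator hδ (ι '' F))), rfl⟩
  set B : Set X := (s \ F) ∪ (Metric.thickening δ F \ F)
  have hpt : ∀ x, ‖((fun x => c * (thickenedIndicator hδ (ι '' F) (ι x) : ℝ)) -
      s.indicator fun _ => c) x‖ ≤ ‖B.indicator (fun _ => c) x‖ := by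
    intro x
    simp only [Pi.sub_apply]
    by_cases hxF : x ∈ F
    · rw [thickenedIndicator_one hδ _ (Set.mem_image_of_mem ι hxF),
        Set.indicator_of_mem (hFs hxF)]
      simp
    · have h01 : (thickenedIndicator hδ (ι '' F) (ι x) : ℝ) ≤ 1 := by
        exact_mod_cast thickenedIndicator_le_one hδ (ι '' F) (ι x)
      have h00 : 0 ≤ (thickenedIndicator hδ (ι '' F) (ι x) : ℝ) := NNReal.coe_nonneg _
      by_cases hxs : x ∈ s
      · rw [Set.indicator_of_mem hxs, Set.indicator_of_mem (s := B) (Or.inl ⟨hxs, hxF⟩),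
          show c * (thickenedIndicator hδ (ι '' F) (ι x) : ℝ) - c =
            c * ((thickenedIndicator hδ (ι '' F) (ι x) : ℝ) - 1) by ring, norm_mul]
        refine mul_le_of_le_one_right (norm_nonneg _) ?_
        rw [Real.norm_eq_abs, abs_le]
        constructor <;> linarith
      · rw [Set.indicator_of_notMem hxs, sub_zero]
        by_cases hxt : x ∈ Metric.thickening δ F
        · rw [Set.indicator_of_mem (s := B) (Or.inr ⟨hxt, hxF⟩), norm_mul]
          refine mul_le_of_le_one_right (norm_nonneg _) ?_
          rwa [Real.norm_of_nonneg h00]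
        · have : ι x ∉ Metric.thickening δ (ι '' F) := by
            rwa [Metric.thickening, Set.mem_ofPred_eq, Metric.infEDist_image hι]
          rw [thickenedIndicator_zero hδ _ this]
          simp
  refine (eLpNorm_mono hpt).trans ((eLpNorm_indicator_const_le c 1).trans ?_)
  simp only [ENNReal.toReal_one, div_one, ENNReal.rpow_one]
  refine le_trans ?_ hηε
  gcongr
  exact (measure_union_le _ _).trans (add_le_add hFη.le hbad)

/-- A bounded density with bounded support is approximated in `L¹` by Lipschitz functions on the
ambient space, with the same bounds and almost the same support. -/
theorem exists_lipschitz_integral_abs_sub_le (hι : Isometry ι) {m : Measure X}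
    (hm : BoundedlyFinite m) {ρ : X → ℝ} (hρ : AEStronglyMeasurable ρ m) {A R : ℝ} (hA : 0 ≤ A)
    (hρ0 : 0 ≤ᵐ[m] ρ) (hρA : ∀ᵐ x ∂m, ρ x ≤ A) {z : Z}
    (hρR : ∀ᵐ x ∂m, ρ x ≠ 0 → dist (ι x) z ≤ R) {η : ℝ} (hη : 0 < η) :
    ∃ (g : Z → ℝ) (K : NNReal), LipschitzWith K g ∧ (∀ x, 0 ≤ g x) ∧ (∀ x, g x ≤ A) ∧
      (∀ x, g x ≠ 0 → dist x z ≤ R + 1) ∧ ∫ x, |ρ x - g (ι x)| ∂m ≤ η := by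
  set S := ι ⁻¹' Metric.closedBall z (R + 1)
  have hS : MeasurableSet S :=
    (Metric.isClosed_closedBall.preimage hι.continuous).measurableSet
  have hfin : IsFiniteMeasure (m.restrict S) :=
    ⟨by rw [Measure.restrict_apply_univ]; exact hm.lt_top_preimage_closedBall hι z _⟩
  have hρabs : ∀ᵐ x ∂m, |ρ x| ≤ A := by
    filter_upwards [hρ0, hρA] with x h0 h1
    rwa [abs_of_nonneg h0]
  have hρi : Integrable ρ m := hm.integrable hι hρ hρabs z hρR
  have hρS : MemLp ρ 1 (m.restrict S) := memLp_one_iff_integrable.2 hρi.integrableOn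
  obtain ⟨_, hG, G, K, hGK, rfl⟩ := hρS.induction_dense ENNReal.one_ne_top
    (fun f : X → ℝ => ∃ (G : Z → ℝ) (K : NNReal), LipschitzWith K G ∧ f = G ∘ ι)
    (fun c s hs _ ε hε => exists_lipschitz_eLpNorm_sub_indicator_le hι _ c hs hε)
    (by
      rintro _ _ ⟨G, K, hG, rfl⟩ ⟨G', K', hG', rfl⟩
      exact ⟨_, _, hG.add hG', rfl⟩)
    (by
      rintro _ ⟨G, K, hG, rfl⟩
      exact (hG.continuous.comp hι.continuous).measurable.aestronglyMeasurable)
    (ε := ENNReal.ofReal η) (by simpa using hη)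
  have hlip : LipschitzWith A.toNNReal fun x => A * (R + 1 - dist x z) := by
    refine LipschitzWith.of_dist_le_mul fun x y => ?_
    rw [Real.dist_eq, ← mul_sub, abs_mul, abs_of_nonneg hA, Real.coe_toNNReal A hA]
    refine mul_le_mul_of_nonneg_left ?_ hA
    rw [show R + 1 - dist x z - (R + 1 - dist y z) = dist y z - dist x z by ring]
    refine (abs_dist_sub_le y x z).trans_eq (dist_comm _ _)
  -- truncation of `G` to `[0, A]`, cut off at distance `R + 1` from `z`
  let g : Z → ℝ := fun x => max 0 (min (min A (G x)) (A * (R + 1 - dist x z)))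
  have hgK : LipschitzWith (max K A.toNNReal) g := ((hGK.const_min A).min hlip).const_max 0
  have hg0 : ∀ x, 0 ≤ g x := fun x => le_max_left _ _
  have hgA : ∀ x, g x ≤ A := fun x =>
    max_le hA ((min_le_left _ _).trans (min_le_left _ _))
  have hgR : ∀ x, g x ≠ 0 → dist x z ≤ R + 1 := fun x hx => by
    by_contra! h
    exact hx (max_eq_left ((min_le_right _ _).trans
      (mul_nonpos_of_nonneg_of_nonpos hA (by linarith))))
  refine ⟨g, _, hgK, hg0, hgA, hgR, ?_⟩
  have hoff : ∀ᵐ x ∂m, |ρ x - g (ι x)| ≤ S.indicator (fun x => |ρ x - G (ι x)|) x := by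
    filter_upwards [hρ0, hρA, hρR] with x h0 h1 h2
    by_cases hx : x ∈ S
    · rw [Set.indicator_of_mem hx]
      by_cases hxR : dist (ι x) z ≤ R
      · have hA1 : A ≤ A * (R + 1 - dist (ι x) z) := le_mul_of_one_le_right hA (by linarith)
        have : g (ι x) = max 0 (min A (G (ι x))) := by
          simp only [g]
          rw [min_eq_left ((min_le_left _ _).trans hA1)]
        rw [this]
        have h3 : ρ x = max 0 (min A (ρ x)) := by
          rw [min_eq_right h1]; exact (max_eq_right h0).symm
        conv_lhs => rw [h3]
        refine (abs_max_sub_max_le_max _ _ _ _).trans ?_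
        rw [sub_self, abs_zero, max_eq_right (abs_nonneg _)]
        refine (abs_min_sub_min_le_max _ _ _ _).trans ?_
        rw [sub_self, abs_zero, max_eq_right (abs_nonneg _)]
      · have hρz : ρ x = 0 := by
          by_contra h
          exact hxR (h2 h)
        rw [hρz, zero_sub, zero_sub, abs_neg, abs_neg, abs_of_nonneg (hg0 _)]
        exact max_le (abs_nonneg _)
          (((min_le_left _ _).trans (min_le_right _ _)).trans (le_abs_self _))
    · rw [Set.indicator_of_notMem hx]
      have hd : ¬ dist (ι x) z ≤ R + 1 := hx
      have hρz : ρ x = 0 := by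
        by_contra h
        exact hd ((h2 h).trans (by linarith))
      have hgz : g (ι x) = 0 := by
        by_contra h
        exact hd (hgR _ h)
      simp [hρz, hgz]
  have hGi : IntegrableOn (fun x => |ρ x - G (ι x)|) S m := by
    have h1 : MemLp (ρ - G ∘ ι) 1 (m.restrict S) :=
      ⟨hρS.1.sub (hGK.continuous.comp hι.continuous).measurable.aestronglyMeasurable,
        hG.trans_lt ENNReal.ofReal_lt_top⟩
    exact (memLp_one_iff_integrable.1 h1).abs
  calc ∫ x, |ρ x - g (ι x)| ∂m ≤ ∫ x, S.indicator (fun x => |ρ x - G (ι x)|) x ∂m :=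
        integral_mono_of_nonneg (ae_of_all _ fun x => abs_nonneg _)
          ((integrable_indicator_iff hS).2 hGi) hoff
    _ = ∫ x in S, |ρ x - G (ι x)| ∂m := integral_indicator hS
    _ = (eLpNorm (ρ - G ∘ ι) 1 (m.restrict S)).toReal := by
        rw [eLpNorm_one_eq_lintegral_enorm, ← integral_norm_eq_lintegral_enorm
          (hρS.1.sub (hGK.continuous.comp hι.continuous).measurable.aestronglyMeasurable)]
        rfl
    _ ≤ η := ENNReal.toReal_le_of_le_ofReal hη.le hG

end Density


/-! ### Strong convergence from `L¹` closeness to test functions -/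

/-- A continuous function is Lipschitz on a compact interval up to an arbitrarily small error. -/
lemma exists_abs_sub_le_add_mul {F : ℝ → ℝ} (hF : Continuous F) (A : ℝ) {η : ℝ} (hη : 0 < η) :
    ∃ L, 0 ≤ L ∧ ∀ a ∈ Set.Icc 0 A, ∀ b ∈ Set.Icc 0 A, |F a - F b| ≤ η + L * |a - b| := by
  have huc := isCompact_Icc.uniformContinuousOn_of_continuous (hF.continuousOn (s := Set.Icc 0 A))
  obtain ⟨δ, hδ, h⟩ := Metric.uniformContinuousOn_iff.1 huc η hη
  obtain ⟨B, hB⟩ := isCompact_Icc.exists_bound_of_continuousOn (hF.continuousOn (s := Set.Icc 0 A))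
  refine ⟨2 * |B| / δ, by positivity, fun a ha b hb => ?_⟩
  rcases lt_or_ge |a - b| δ with hab | hab
  · have h1 := h a ha b hb hab
    rw [Real.dist_eq] at h1
    have : 0 ≤ 2 * |B| / δ * |a - b| := by positivity
    linarith
  · have h1 : |F a - F b| ≤ 2 * |B| := by
      refine (abs_sub _ _).trans ?_
      have h2 := hB a ha
      have h3 := hB b hb
      rw [Real.norm_eq_abs] at h2 h3
      linarith [le_abs_self B]
    have h2 : 2 * |B| ≤ 2 * |B| / δ * |a - b| := by
      rw [div_mul_eq_mul_div, le_div_iff₀ hδ]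
      exact mul_le_mul_of_nonneg_left hab (by positivity)
    linarith

/-- The functional `f ↦ ∫ φ F(f)` is `L¹`-Lipschitz up to a small error. -/
lemma abs_integral_mul_comp_sub_le {X : Type*} [MeasurableSpace X] {μ : Measure X}
    {φ f g : X → ℝ} {F : ℝ → ℝ} {A K L η : ℝ} (hF : Continuous F) (hL : 0 ≤ L)
    (hFL : ∀ a ∈ Set.Icc 0 A, ∀ b ∈ Set.Icc 0 A, |F a - F b| ≤ η + L * |a - b|)
    (hφ : Integrable φ μ) (hφK : ∀ x, |φ x| ≤ K) (hf : Integrable f μ) (hg : Integrable g μ)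
    (hfA : ∀ᵐ x ∂μ, f x ∈ Set.Icc 0 A) (hgA : ∀ᵐ x ∂μ, g x ∈ Set.Icc 0 A) :
    |∫ x, φ x * F (f x) ∂μ - ∫ x, φ x * F (g x) ∂μ| ≤
      η * ∫ x, |φ x| ∂μ + L * K * ∫ x, |f x - g x| ∂μ := by
  obtain ⟨B, hB⟩ := isCompact_Icc.exists_bound_of_continuousOn (hF.continuousOn (s := Set.Icc 0 A))
  have hint : ∀ f : X → ℝ, Integrable f μ → (∀ᵐ x ∂μ, f x ∈ Set.Icc 0 A) →
      Integrable (fun x => φ x * F (f x)) μ := fun f hf hfA =>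
    hφ.mul_bdd (c := B) (hF.comp_aestronglyMeasurable hf.1) (hfA.mono fun x hx => hB _ hx)
  have hfg : Integrable (fun x => |f x - g x|) μ := (hf.sub hg).abs
  rw [← integral_sub (hint f hf hfA) (hint g hg hgA), ← integral_const_mul, ← integral_const_mul,
    ← integral_add (hφ.abs.const_mul _) (hfg.const_mul _)]
  refine abs_integral_le_integral_abs.trans ?_
  refine integral_mono_ae ((hint f hf hfA).sub (hint g hg hgA)).abs
    ((hφ.abs.const_mul _).add (hfg.const_mul _)) ?_
  filter_upwards [hfA, hgA] with x h1 h2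
  simp only [← mul_sub, abs_mul]
  have h3 := mul_le_mul_of_nonneg_left (hFL _ h1 _ h2) (abs_nonneg (φ x))
  have h4 := mul_le_mul_of_nonneg_right (hφK x)
    (mul_nonneg hL (abs_nonneg (f x - g x)))
  linarith

lemma continuous_signedSqrt : Continuous signedSqrt := by
  have : signedSqrt = fun t => √t - √(-t) := by
    funext t
    rcases lt_trichotomy t 0 with h | rfl | h
    · rw [signedSqrt, Real.sign_of_neg h, abs_of_neg h, Real.sqrt_eq_zero_of_nonpos h.le]; ring
    · simp [signedSqrt]
    · rw [signedSqrt, Real.sign_of_pos h, abs_of_pos h,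
        Real.sqrt_eq_zero_of_nonpos (neg_nonpos.2 h.le)]; ring
  rw [this]
  fun_prop

section Strong

variable {X : ℕ → Type*} {Xinf Z : Type*}
    [∀ n, MetricSpace (X n)] [∀ n, MeasurableSpace (X n)] [∀ n, BorelSpace (X n)]
    [MetricSpace Xinf] [MeasurableSpace Xinf] [BorelSpace Xinf]
    [MetricSpace Z] [MeasurableSpace Z] [BorelSpace Z]
    {m : ∀ n, Measure (X n)} {x : ∀ n, X n} {minf : Measure Xinf} {xinf : Xinf}
    {ι : ∀ n, X n → Z} {ιinf : Xinf → Z} {f : ∀ n, X n → ℝ} {ρ : Xinf → ℝ} {A R : ℝ} {z : Z}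

/-- The functions `f n` approximate `ρ` in `L¹`, in the sense that asymptotically they are as close
as `ρ` to every Lipschitz test function. -/
def L1Close (m : ∀ n, Measure (X n)) (minf : Measure Xinf) (ι : ∀ n, X n → Z) (ιinf : Xinf → Z)
    (f : ∀ n, X n → ℝ) (ρ : Xinf → ℝ) : Prop :=
  ∀ (g : Z → ℝ) (K : NNReal), LipschitzWith K g → IsTest g → ∀ η > 0,
    ∀ᶠ n in atTop, ∫ a, |f n a - g (ι n a)| ∂(m n) ≤ ∫ a, |ρ a - g (ιinf a)| ∂minf + η

/-- Under `L¹` closeness, `F ∘ f n` converges weakly to `F ∘ ρ` for every continuous `F`. The two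
functions are compared with `F ∘ g` for a Lipschitz `g` close to `ρ`. -/
theorem tendsto_integral_mul_comp (hm : ∀ n, BoundedlyFinite (m n)) (hminf : BoundedlyFinite minf)
    (hreal : IsRealization m x minf xinf ι ιinf) (hA : 0 ≤ A)
    (hρ : AEStronglyMeasurable ρ minf) (hρ0 : 0 ≤ᵐ[minf] ρ) (hρA : ∀ᵐ a ∂minf, ρ a ≤ A)
    (hρR : ∀ᵐ a ∂minf, ρ a ≠ 0 → dist (ιinf a) z ≤ R)
    (hf : ∀ n, Measurable (f n)) (hf0 : ∀ n a, 0 ≤ f n a)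
    (hfA : ∀ᶠ n in atTop, ∀ a, f n a ≤ A) (hfR : ∀ n a, f n a ≠ 0 → dist (ι n a) z ≤ R)
    (hclose : L1Close m minf ι ιinf f ρ) {F : ℝ → ℝ} (hF : Continuous F) {φ : Z → ℝ}
    (hφ : IsTest φ) :
    Tendsto (fun n => ∫ a, φ (ι n a) * F (f n a) ∂(m n)) atTop
      (𝓝 (∫ a, φ (ιinf a) * F (ρ a) ∂minf)) := by
  rw [Metric.tendsto_atTop']
  intro ε hε
  obtain ⟨K, hK⟩ := hφ.bounded
  have hK0 : 0 ≤ K := (abs_nonneg _).trans (hK z)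
  set I := ∫ a, |φ (ιinf a)| ∂minf with hI
  have hI0 : 0 ≤ I := integral_nonneg fun _ => abs_nonneg _
  set η := ε / (8 * (I + 1)) with hη
  have hη0 : 0 < η := by positivity
  obtain ⟨L, hL, hFL⟩ := exists_abs_sub_le_add_mul hF A hη0
  set η' := ε / (8 * (L * K + 1)) with hη'
  have hη'0 : 0 < η' := by positivity
  obtain ⟨g, Kg, hgK, hg0, hgA, hgR, hgρ⟩ := exists_lipschitz_integral_abs_sub_le
    hreal.isometry_inf hminf hρ hA hρ0 hρA hρR hη'0
  have hgabs : ∀ x, |g x| ≤ A := fun x => by rw [abs_of_nonneg (hg0 x)]; exact hgA x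
  have hgt : IsTest g := IsTest.of_le hgK.continuous hgabs z hgR
  obtain ⟨B, hB⟩ := isCompact_Icc.exists_bound_of_continuousOn (hF.continuousOn (s := Set.Icc 0 A))
  have hφF : IsTest fun x => φ x * F (g x) :=
    hφ.mul (hF.comp hgK.continuous) fun x => hB _ ⟨hg0 x, hgA x⟩
  have hρi : Integrable ρ minf := hminf.integrable hreal.isometry_inf hρ
    (by filter_upwards [hρ0, hρA] with a h0 h1; rwa [abs_of_nonneg h0]) z hρR
  have hlim := hreal.tendsto_test hφF
  have hlim' := hreal.tendsto_test hφ.abs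
  obtain ⟨N, hN⟩ := eventually_atTop.1 ((hclose g Kg hgK hgt η' hη'0).and (hfA.and
    ((hlim'.eventually (gt_mem_nhds (lt_add_one I))).and
      (Metric.tendsto_nhds.1 hlim (ε / 8) (by positivity)))))
  refine ⟨N, fun n hn => ?_⟩
  obtain ⟨h1, h2, h3, h4⟩ := hN n hn.le
  have hfi : Integrable (f n) (m n) := (hm n).integrable (hreal.isometry n)
    (hf n).aestronglyMeasurable
    (ae_of_all _ fun a => by rw [abs_of_nonneg (hf0 n a)]; exact h2 a) z (ae_of_all _ (hfR n))
  have e1 := abs_integral_mul_comp_sub_le hF hL hFL (hφ.integrable (hm n) (hreal.isometry n))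
    (fun a => hK (ι n a)) hfi (hgt.integrable (hm n) (hreal.isometry n))
    (ae_of_all _ fun a => ⟨hf0 n a, h2 a⟩) (ae_of_all _ fun a => ⟨hg0 _, hgA _⟩)
  have e2 := abs_integral_mul_comp_sub_le hF hL hFL (hφ.integrable hminf hreal.isometry_inf)
    (fun a => hK (ιinf a)) hρi (hgt.integrable hminf hreal.isometry_inf)
    (by filter_upwards [hρ0, hρA] with a h0 h1; exact ⟨h0, h1⟩)
    (ae_of_all _ fun a => ⟨hg0 _, hgA _⟩)
  rw [Real.dist_eq] at h4 ⊢
  have hηI : η * (I + 1) = ε / 8 := by rw [hη]; field_simp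
  have hηI' : η' * (L * K + 1) = ε / 8 := by rw [hη']; field_simp
  have e3 : η * ∫ a, |φ (ι n a)| ∂(m n) ≤ η * (I + 1) := mul_le_mul_of_nonneg_left h3.le hη0.le
  have e4 : L * K * ∫ a, |f n a - g (ι n a)| ∂(m n) ≤ L * K * (η' + η') :=
    mul_le_mul_of_nonneg_left (h1.trans (by linarith)) (mul_nonneg hL hK0)
  have e5 : L * K * ∫ a, |ρ a - g (ιinf a)| ∂minf ≤ L * K * η' :=
    mul_le_mul_of_nonneg_left hgρ (mul_nonneg hL hK0)
  rw [abs_le] at e1 e2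
  rw [abs_lt] at h4 ⊢
  constructor <;> nlinarith

/-- `L¹` closeness and uniform bounds give strong `L^p` convergence, also after composition with a
continuous function vanishing at `0`. -/
theorem strongLpConvAux_comp (hm : ∀ n, BoundedlyFinite (m n)) (hminf : BoundedlyFinite minf)
    (hreal : IsRealization m x minf xinf ι ιinf) (hA : 0 ≤ A)
    (hρ : AEStronglyMeasurable ρ minf) (hρ0 : 0 ≤ᵐ[minf] ρ) (hρA : ∀ᵐ a ∂minf, ρ a ≤ A)
    (hρR : ∀ᵐ a ∂minf, ρ a ≠ 0 → dist (ιinf a) z ≤ R)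
    (hf : ∀ n, Measurable (f n)) (hf0 : ∀ n a, 0 ≤ f n a) (hfB : ∀ n, ∃ C, ∀ a, f n a ≤ C)
    (hfA : ∀ᶠ n in atTop, ∀ a, f n a ≤ A) (hfR : ∀ n a, f n a ≠ 0 → dist (ι n a) z ≤ R)
    (hclose : L1Close m minf ι ιinf f ρ) {h : ℝ → ℝ} (hh : Continuous h) (h0 : h 0 = 0)
    {p : ℝ≥0∞} (hp0 : p ≠ 0) (hp : p ≠ ∞) :
    StrongLpConvAux m minf ι ιinf p (fun n a => h (f n a)) (fun a => h (ρ a)) := by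
  have hp' : 0 < p.toReal := ENNReal.toReal_pos hp0 hp
  have hpow : Continuous fun t => ‖h t‖ ^ p.toReal := hh.norm.rpow_const fun _ => Or.inr hp'.le
  have hpow0 : ‖h 0‖ ^ p.toReal = 0 := by rw [h0, norm_zero, Real.zero_rpow hp'.ne']
  have hmem : ∀ n, MemLp (fun a => h (f n a)) p (m n) := fun n => by
    obtain ⟨C, hC⟩ := hfB n
    obtain ⟨B, hB⟩ :=
      isCompact_Icc.exists_bound_of_continuousOn (hpow.continuousOn (s := Set.Icc 0 C))
    refine (integrable_norm_rpow_iff (hh.measurable.comp (hf n)).aestronglyMeasurable hp0 hp).1 ?_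
    exact (hm n).integrable (hreal.isometry n)
      (hpow.measurable.comp (hf n)).aestronglyMeasurable
      (ae_of_all _ fun a => hB _ ⟨hf0 n a, hC a⟩) z (ae_of_all _ fun a ha => hfR n a fun h' =>
        ha (by change ‖h (f n a)‖ ^ p.toReal = 0; rw [h', hpow0]))
  have hmem_inf : MemLp (fun a => h (ρ a)) p minf := by
    obtain ⟨B, hB⟩ :=
      isCompact_Icc.exists_bound_of_continuousOn (hpow.continuousOn (s := Set.Icc 0 A))
    refine (integrable_norm_rpow_iff (hh.comp_aestronglyMeasurable hρ) hp0 hp).1 ?_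
    refine hminf.integrable hreal.isometry_inf (K := B) (R := R)
      (hpow.comp_aestronglyMeasurable hρ) ?_ z ?_
    · filter_upwards [hρ0, hρA] with a h1 h2 using hB _ ⟨h1, h2⟩
    · filter_upwards [hρR] with a ha h1
      exact ha fun h' => h1 (by simp only [h', hpow0])
  -- the `p`-th power of the norm is tested against a cutoff equal to `1` on the common support
  obtain ⟨ψ, hψ, hψ1⟩ := exists_isTest_eq_one z R
  have hlim := tendsto_integral_mul_comp hm hminf hreal hA hρ hρ0 hρA hρR hf hf0 hfA hfR hclose
    hpow hψ
  have hlim' : Tendsto (fun n => ∫ a, ‖h (f n a)‖ ^ p.toReal ∂(m n)) atTop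
      (𝓝 (∫ a, ‖h (ρ a)‖ ^ p.toReal ∂minf)) := by
    have e1 : ∫ a, ‖h (ρ a)‖ ^ p.toReal ∂minf =
        ∫ a, ψ (ιinf a) * ‖h (ρ a)‖ ^ p.toReal ∂minf := by
      refine integral_congr_ae ?_
      filter_upwards [hρR] with a ha
      by_cases h' : ρ a = 0
      · simp only [h', hpow0, mul_zero]
      · rw [hψ1 _ (ha h'), one_mul]
    rw [e1]
    refine hlim.congr fun n => integral_congr_ae (ae_of_all _ fun a => ?_)
    by_cases h' : f n a = 0
    · simp only [h', hpow0, mul_zero]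
    · simp only [hψ1 _ (hfR n a h'), one_mul]
  have hroot := hlim'.rpow_const (p := p.toReal⁻¹) (Or.inr (inv_nonneg.2 hp'.le))
  have hnorm : Tendsto (fun n => eLpNorm (fun a => h (f n a)) p (m n)) atTop
      (𝓝 (eLpNorm (fun a => h (ρ a)) p minf)) := by
    rw [hmem_inf.eLpNorm_eq_integral_rpow_norm hp0 hp]
    simp_rw [fun n => (hmem n).eLpNorm_eq_integral_rpow_norm hp0 hp]
    exact (ENNReal.continuous_ofReal.tendsto _).comp hroot
  refine ⟨⟨hmem, hmem_inf, ?_, fun φ hφ => ?_⟩, hnorm.limsup_eq.le⟩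
  · obtain ⟨B, hB⟩ := hroot.bddAbove_range
    refine (iSup_le fun n => ?_).trans_lt (ENNReal.ofReal_lt_top (r := B))
    rw [(hmem n).eLpNorm_eq_integral_rpow_norm hp0 hp]
    exact ENNReal.ofReal_le_ofReal (hB ⟨n, rfl⟩)
  · exact tendsto_integral_mul_comp hm hminf hreal hA hρ hρ0 hρA hρR hf hf0 hfA hfR hclose
      hh (IsTest.of_mem_Cbs hφ)

theorem strongLpConv_of_l1Close (hm : ∀ n, BoundedlyFinite (m n)) (hminf : BoundedlyFinite minf)
    (hreal : IsRealization m x minf xinf ι ιinf) (hA : 0 ≤ A)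
    (hρ : AEStronglyMeasurable ρ minf) (hρ0 : 0 ≤ᵐ[minf] ρ) (hρA : ∀ᵐ a ∂minf, ρ a ≤ A)
    (hρR : ∀ᵐ a ∂minf, ρ a ≠ 0 → dist (ιinf a) z ≤ R)
    (hf : ∀ n, Measurable (f n)) (hf0 : ∀ n a, 0 ≤ f n a) (hfB : ∀ n, ∃ C, ∀ a, f n a ≤ C)
    (hfA : ∀ᶠ n in atTop, ∀ a, f n a ≤ A) (hfR : ∀ n a, f n a ≠ 0 → dist (ι n a) z ≤ R)
    (hclose : L1Close m minf ι ιinf f ρ) {q : ℝ≥0∞} (hq1 : 1 ≤ q) (hq : q < ∞) :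
    StrongLpConv m minf ι ιinf q f ρ := by
  have key := fun (h : ℝ → ℝ) (hh : Continuous h) (h0 : h 0 = 0) (p : ℝ≥0∞) (hp0 : p ≠ 0)
    (hp : p ≠ ∞) => strongLpConvAux_comp hm hminf hreal hA hρ hρ0 hρA hρR hf hf0 hfB hfA hfR hclose
      hh h0 hp0 hp
  have hid := fun p => key id continuous_id rfl p
  rw [StrongLpConv]
  split_ifs with h
  · have h1 := (hid 1 one_ne_zero ENNReal.one_ne_top).weak
    exact ⟨h1.memLp, h1.memLp_inf,
      key signedSqrt continuous_signedSqrt (by simp [signedSqrt]) 2 (by simp) (by simp)⟩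
  · exact hid q (by rintro rfl; simp at hq1) hq.ne

end Strong


/-! ### Nearly optimal chains and the good event -/

lemma exists_adm_le_add {X : Type*} [MetricSpace X] [MeasurableSpace X] (μ ν : Measure X)
    [IsProbabilityMeasure μ] [IsProbabilityMeasure ν] {ε : ℝ≥0∞} (hε : ε ≠ 0) :
    ∃ α ∈ Adm μ ν, eLpNorm (fun p : X × X => dist p.1 p.2) ∞ α ≤ Winf μ ν + ε := by
  by_cases h : Winf μ ν = ∞
  · exact ⟨μ.prod ν, by simp [Adm], by simp [h]⟩
  · have h1 : Winf μ ν < Winf μ ν + ε := ENNReal.lt_add_right h hε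
    conv_lhs at h1 => rw [Winf]
    simp only [iInf_lt_iff] at h1
    obtain ⟨α, hα, hlt⟩ := h1
    exact ⟨α, hα, hlt.le⟩

theorem exists_near_optimal_chain.{u} {X : Type u} [MetricSpace X] [CompleteSpace X]
    [TopologicalSpace.SeparableSpace X] [MeasurableSpace X] [BorelSpace X] [Nonempty X] {M : ℕ}
    (μ : Fin (M + 1) → Measure X) [∀ i, IsProbabilityMeasure (μ i)] {ε : ℝ≥0∞} (hε : ε ≠ 0) :
    ∃ (Ω : Type u) (_ : MeasurableSpace Ω) (P : Measure Ω) (Y : ℕ → Ω → X),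
      IsProbabilityMeasure P ∧ (∀ i, Measurable (Y i)) ∧
      (∀ i : Fin (M + 1), P.map (Y i) = μ i) ∧
      ∀ i : Fin M, ∀ᵐ ω ∂P, edist (Y i ω) (Y (i + 1) ω) ≤ Winf (μ i.castSucc) (μ i.succ) + ε := by
  have : SecondCountableTopology X := UniformSpace.secondCountable_of_separable X
  have : PolishSpace X := inferInstance
  choose α hα hαle using fun i : Fin M => exists_adm_le_add (μ i.castSucc) (μ i.succ) hε
  let μ' : ℕ → Measure X := fun i => μ (Fin.ofNat (M + 1) i)
  let α' : ℕ → Measure (X × X) := fun i => if h : i < M then α ⟨i, h⟩ else 0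
  have hμ' : ∀ i : Fin (M + 1), μ' i = μ i := fun i => by simp [μ']
  have hα' : ∀ i < M, α' i ∈ Adm (μ' i) (μ' (i + 1)) := by
    intro i hi
    have h1 := hμ' (Fin.castSucc ⟨i, hi⟩)
    have h2 := hμ' (Fin.succ ⟨i, hi⟩)
    simp only [Fin.val_castSucc, Fin.val_succ] at h1 h2
    rw [h1, h2]
    simpa only [α', hi, dif_pos] using hα ⟨i, hi⟩
  obtain ⟨Ω, _, P, Y, hP, hY, hlaw, hpair⟩ := exists_chain_of_plans μ' α' M hα'
  refine ⟨Ω, _, P, Y, hP, hY, fun i => ?_, fun i => ?_⟩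
  · rw [hlaw i (Nat.lt_succ_iff.1 i.2), hμ']
  · have h1 := hpair i i.2
    simp only [α', i.2, dif_pos] at h1
    have h2 : ∀ᵐ p ∂(α i), edist p.1 p.2 ≤ Winf (μ i.castSucc) (μ i.succ) + ε := by
      have h3 := ae_le_eLpNormEssSup (f := fun p : X × X => dist p.1 p.2) (μ := α i)
      filter_upwards [h3] with p hp
      rw [edist_dist, ← Real.enorm_of_nonneg dist_nonneg]
      refine hp.trans ?_
      rw [← eLpNorm_exponent_top]
      exact hαle i
    rw [← h1] at h2
    exact ae_of_ae_map ((hY i).prodMk (hY (i + 1))).aemeasurable h2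

/-- With probability close to `1`, all variables of the chain stay close to finitely many of the
centres. -/
lemma exists_good_event {Ω X Z : Type*} [MeasurableSpace Ω] [MeasurableSpace X] [MetricSpace Z]
    {P : Measure Ω} [IsProbabilityMeasure P] [MetricSpace X] [BorelSpace X] {Y : ℕ → Ω → X}
    (hY : ∀ i, Measurable (Y i)) {ι : X → Z} (hι : Continuous ι) {M : ℕ} {c : ℕ → Z} {s θ : ℝ}
    (hc : ∀ i ≤ M, ∀ᵐ ω ∂P, ∃ l, dist (ι (Y i ω)) (c l) ≤ s) (hθ : 0 < θ) :
    ∃ (J : ℕ) (E : Set Ω), MeasurableSet E ∧ 1 - θ ≤ P.real E ∧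
      ∀ ω ∈ E, ∀ i ≤ M, ∃ l < J, dist (ι (Y i ω)) (c l) ≤ s := by
  let E : ℕ → Set Ω := fun J =>
    ⋂ i ∈ Finset.range (M + 1), ⋃ l ∈ Finset.range J, {ω | dist (ι (Y i ω)) (c l) ≤ s}
  have hmem : ∀ J ω, ω ∈ E J ↔ ∀ i ≤ M, ∃ l < J, dist (ι (Y i ω)) (c l) ≤ s := by
    intro J ω
    simp [E]
  have hE : ∀ J, MeasurableSet (E J) := fun J =>
    Finset.measurableSet_biInter _ fun i _ => Finset.measurableSet_biUnion _ fun l _ =>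
      ((hι.dist continuous_const).measurable.comp (hY i)) measurableSet_Iic
  have hmono : Monotone E := fun J J' h ω hω => by
    rw [hmem] at hω ⊢
    intro i hi
    obtain ⟨l, hl, hd⟩ := hω i hi
    exact ⟨l, hl.trans_le h, hd⟩
  have hfull : P (⋃ J, E J) = 1 := by
    rw [prob_compl_eq_zero_iff (MeasurableSet.iUnion hE) |>.symm]
    have h1 : ∀ᵐ ω ∂P, ∀ i : Fin (M + 1), ∃ l, dist (ι (Y i ω)) (c l) ≤ s :=
      ae_all_iff.2 fun i => hc i (Nat.lt_succ_iff.1 i.2)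
    refine mem_ae_iff.1 ?_
    filter_upwards [h1] with ω hω
    choose l hl using hω
    obtain ⟨B, hB⟩ := (Set.finite_range l).bddAbove
    refine Set.mem_iUnion.2 ⟨B + 1, (hmem _ _).2 fun i hi => ⟨l ⟨i, by omega⟩, ?_, hl ⟨i, by omega⟩⟩⟩
    exact Nat.lt_succ_of_le (hB ⟨_, rfl⟩)
  have hlim := tendsto_measure_iUnion_atTop (μ := P) hmono
  rw [hfull] at hlim
  have hlim' : Tendsto (fun J => P.real (E J)) atTop (𝓝 1) := by
    simpa using! (ENNReal.tendsto_toReal ENNReal.one_ne_top).comp hlim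
  obtain ⟨J, hJ⟩ := (hlim'.eventually (lt_mem_nhds (show 1 - θ < 1 by linarith))).exists
  exact ⟨J, E J, hE J, hJ.le, fun ω hω => (hmem J ω).1 hω⟩

/-! ### Densities -/

section BoundedDensity

variable {X : Type*} [MeasurableSpace X] {m : Measure X} {ρ : X → ℝ}

lemma IsBoundedProbDensity.isProbabilityMeasure (h : IsBoundedProbDensity m ρ) :
    IsProbabilityMeasure (densityMeasure m ρ) :=
  ⟨by rw [densityMeasure, withDensity_apply _ .univ, setLIntegral_univ]; exact h.lintegral_eq_one⟩

lemma IsBoundedProbDensity.integral_densityMeasure (h : IsBoundedProbDensity m ρ) (φ : X → ℝ) :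
    ∫ x, φ x ∂(densityMeasure m ρ) = ∫ x, φ x * ρ x ∂m := by
  rw [densityMeasure, integral_withDensity_eq_integral_toReal_smul₀
    h.memLp_top.1.aemeasurable.ennreal_ofReal (ae_of_all _ fun _ => ENNReal.ofReal_lt_top)]
  refine integral_congr_ae ?_
  filter_upwards [h.nonneg] with x hx
  rw [ENNReal.toReal_ofReal hx, smul_eq_mul, mul_comm]

lemma IsBoundedProbDensity.integrable (h : IsBoundedProbDensity m ρ) : Integrable ρ m := by
  refine ⟨h.memLp_top.1, ?_⟩
  rw [hasFiniteIntegral_iff_ofReal h.nonneg, h.lintegral_eq_one]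
  exact ENNReal.one_lt_top

lemma IsBoundedProbDensity.integral_eq_one (h : IsBoundedProbDensity m ρ) : ∫ x, ρ x ∂m = 1 := by
  rw [integral_eq_lintegral_of_nonneg_ae h.nonneg h.memLp_top.1, h.lintegral_eq_one]
  rfl

lemma IsBoundedProbDensity.ae_le (h : IsBoundedProbDensity m ρ) :
    ∀ᵐ x ∂m, ρ x ≤ (eLpNorm ρ ∞ m).toReal := by
  filter_upwards [ae_le_eLpNormEssSup (f := ρ) (μ := m)] with x hx
  rw [← eLpNorm_exponent_top] at hx
  have := ENNReal.toReal_mono h.memLp_top.2.ne hx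
  rw [toReal_enorm] at this
  exact (le_abs_self _).trans this

lemma isBoundedProbDensity_of_bounded {f : X → ℝ} (hf : Measurable f) (h0 : ∀ x, 0 ≤ f x)
    {C : ℝ} (hC : ∀ x, f x ≤ C) (h1 : ∫ x, f x ∂m = 1) : IsBoundedProbDensity m f := by
  refine ⟨memLp_top_of_bound hf.aestronglyMeasurable C
    (ae_of_all _ fun x => by rw [Real.norm_of_nonneg (h0 x)]; exact hC x), ae_of_all _ h0, ?_⟩
  have hi : Integrable f m := by
    by_contra h
    rw [integral_undef h] at h1
    exact zero_ne_one h1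
  rw [← ofReal_integral_eq_lintegral_ofReal hi (ae_of_all _ h0), h1, ENNReal.ofReal_one]

lemma ae_mem_of_essSupport_subset {X Z : Type*} [MetricSpace X]
    [TopologicalSpace.SeparableSpace X] [MeasurableSpace X] [BorelSpace X] {m : Measure X}
    {ρ : X → ℝ} (hρ : AEStronglyMeasurable ρ m) {ι : X → Z} {S : Set Z}
    (h : ι '' essSupport m ρ ⊆ S) : ∀ᵐ x ∂m, ρ x ≠ 0 → ι x ∈ S := by
  have : SecondCountableTopology X := UniformSpace.secondCountable_of_separable X
  have h1 := Measure.support_mem_ae (μ := m.withDensity fun a => ‖ρ a‖ₑ)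
  have h2 : ∀ᵐ x ∂m.withDensity fun a => ‖ρ a‖ₑ, x ∈ essSupport m ρ := h1
  rw [ae_withDensity_iff' hρ.enorm] at h2
  filter_upwards [h2] with x hx h0
  exact h ⟨x, hx (by simpa using h0), rfl⟩

lemma essSupport_subset {X Z : Type*} [MetricSpace X] [MeasurableSpace X] [BorelSpace X]
    [MetricSpace Z] {m : Measure X} {f : X → ℝ} (hf : Measurable f) {ι : X → Z}
    (hι : Continuous ι) {S : Set Z} (hS : IsClosed S) (h : ∀ x, f x ≠ 0 → ι x ∈ S) :
    ι '' essSupport m f ⊆ S := by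
  rw [Set.image_subset_iff]
  refine Measure.support_subset_of_isClosed (hS.preimage hι) ?_
  change ∀ᵐ x ∂m.withDensity fun a => ‖f a‖ₑ, x ∈ ι ⁻¹' S
  rw [ae_withDensity_iff hf.enorm]
  exact ae_of_all _ fun x hx => h x (by simpa using hx)

end BoundedDensity

section SmearBounds

variable {X : Type*} [MeasurableSpace X] {m : Measure X} {χ : ℕ → X → ℝ} {J : ℕ} {w : ℕ → ℝ}

lemma smear_le (hχ0 : ∀ j x, 0 ≤ χ j x) (hχs : ∀ x, ∑ j ∈ Finset.range J, χ j x ≤ 1) {B : ℝ}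
    (hB : 0 ≤ B) (hw : ∀ j < J, w j / (∫ a, χ j a ∂m) ≤ B) (x : X) : smear m χ J w x ≤ B :=
  calc smear m χ J w x ≤ ∑ j ∈ Finset.range J, B * χ j x :=
        Finset.sum_le_sum fun j hj =>
          mul_le_mul_of_nonneg_right (hw j (Finset.mem_range.1 hj)) (hχ0 j x)
    _ ≤ B := by rw [← Finset.mul_sum]; exact mul_le_of_le_one_right hB (hχs x)

lemma exists_of_smear_ne_zero {x : X} (h : smear m χ J w x ≠ 0) : ∃ j, χ j x ≠ 0 := by
  obtain ⟨j, _, hj⟩ := Finset.exists_ne_zero_of_sum_ne_zero h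
  exact ⟨j, right_ne_zero_of_mul hj⟩

lemma integral_smear (hχi : ∀ j, Integrable (χ j) m)
    (hw : ∀ j < J, w j ≠ 0 → ∫ x, χ j x ∂m ≠ 0) :
    ∫ x, smear m χ J w x ∂m = ∑ j ∈ Finset.range J, w j := by
  unfold smear
  rw [integral_finsetSum _ fun j _ => (hχi j).const_mul _]
  refine Finset.sum_congr rfl fun j hj => ?_
  rw [integral_const_mul]
  by_cases h : w j = 0
  · simp [h]
  · rw [div_mul_cancel₀ _ (hw j (Finset.mem_range.1 hj) h)]

end SmearBounds


/-! ### Approximation at a fixed precision -/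

section Level

/-- Small bumps whose centres are dense in the ball of radius `R` form a partition of unity near the
closed ball of radius `r`, in the sense that finitely many of them add up to `1` near the
corresponding centres. -/
lemma exists_partition {Z : Type*} [MetricSpace Z] [TopologicalSpace.SeparableSpace Z] (z : Z)
    {r R δ : ℝ} (hrR : r < R) (hr : 0 ≤ r) (hδ : 0 < δ) :
    ∃ (χ : ℕ → Z → ℝ) (c : ℕ → Z), (∀ j, Continuous (χ j)) ∧ (∀ j y, 0 ≤ χ j y) ∧
      (∀ j y, χ j y ≤ 1) ∧ (∀ J y, ∑ j ∈ Finset.range J, χ j y ≤ 1) ∧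
      (∀ j y, χ j y ≠ 0 → dist y (c j) < δ) ∧ (∀ j, dist (c j) z < R) ∧
      (∀ y, dist y z ≤ r → ∃ l, dist y (c l) ≤ δ / 2) ∧
      ∀ J, ∀ l < J, ∀ y, dist y (c l) ≤ δ / 2 → ∑ j ∈ Finset.range J, χ j y = 1 := by
  have : SecondCountableTopology Z := UniformSpace.secondCountable_of_separable Z
  have : Nonempty (Metric.ball z R) := ⟨⟨z, Metric.mem_ball_self (hr.trans_lt hrR)⟩⟩
  let c : ℕ → Z := fun j => (TopologicalSpace.denseSeq (Metric.ball z R) j : Z)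
  refine ⟨pou δ c, c, continuous_pou, pou_nonneg, pou_le_one, sum_pou_le_one,
    fun j y => dist_lt_of_pou_ne_zero hδ,
    fun j => (TopologicalSpace.denseSeq (Metric.ball z R) j).2, fun y hy => ?_,
    fun J l hl y => sum_pou_eq_one hδ hl⟩
  obtain ⟨l, hl⟩ := (TopologicalSpace.denseRange_denseSeq
    (Metric.ball z R)).exists_dist_lt ⟨y, hy.trans_lt hrR⟩ (half_pos hδ)
  exact ⟨l, hl.le⟩

/-- The masses of a partition supported in a closed ball add up to at most the mass of
that ball. -/
lemma sum_integral_pou_le {X Z : Type*} [MetricSpace X] [MeasurableSpace X] [BorelSpace X]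
    [MetricSpace Z] {m : Measure X} (hm : BoundedlyFinite m) {ι : X → Z} (hι : Isometry ι)
    {χ : ℕ → Z → ℝ} (hχt : ∀ j, IsTest (χ j)) {J : ℕ}
    (hχs : ∀ x, ∑ j ∈ Finset.range J, χ j x ≤ 1) {z : Z} {R : ℝ}
    (hR : ∀ j x, χ j x ≠ 0 → dist x z ≤ R) :
    ∑ j ∈ Finset.range J, ∫ x, χ j (ι x) ∂m ≤ m.real (ι ⁻¹' Metric.closedBall z R) := by
  have hS : MeasurableSet (ι ⁻¹' Metric.closedBall z R) :=
    (Metric.isClosed_closedBall.preimage hι.continuous).measurableSet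
  rw [← integral_finsetSum _ fun j _ => (hχt j).integrable hm hι, ← integral_indicator_one hS]
  refine integral_mono (integrable_finsetSum _ fun j _ => (hχt j).integrable hm hι)
    ((integrable_indicator_iff hS).2
      (integrableOn_const (hs := (hm.lt_top_preimage_closedBall hι z R).ne))) fun x => ?_
  by_cases h : x ∈ ι ⁻¹' Metric.closedBall z R
  · simpa [Set.indicator_of_mem h] using hχs (ι x)
  · rw [Set.indicator_of_notMem h]
    refine le_of_eq (Finset.sum_eq_zero fun j _ => ?_)
    by_contra h'
    exact h (hR j _ h')

variable {X : ℕ → Type*} {Xinf Z : Type*}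
    [∀ n, MetricSpace (X n)] [∀ n, MeasurableSpace (X n)] [∀ n, BorelSpace (X n)]
    [MetricSpace Xinf] [CompleteSpace Xinf] [TopologicalSpace.SeparableSpace Xinf]
    [MeasurableSpace Xinf] [BorelSpace Xinf]
    [MetricSpace Z] [TopologicalSpace.SeparableSpace Z] [MeasurableSpace Z] [BorelSpace Z]
    {m : ∀ n, Measure (X n)} {x : ∀ n, X n} {minf : Measure Xinf} {xinf : Xinf}
    {ι : ∀ n, X n → Z} {ιinf : Xinf → Z}

/-- The densities `f i` on `X` approximate the densities `ρ i` on `Xinf` with precision `ε`. The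
last clause bounds the `L¹` distance to Lipschitz test functions, up to the error made by the
measure `m` itself. -/
structure IsLevelApprox {X Xinf Z : Type*} [MetricSpace X] [MeasurableSpace X]
    [MetricSpace Xinf] [MeasurableSpace Xinf] [MetricSpace Z] (m : Measure X)
    (minf : Measure Xinf) (ι : X → Z) (ιinf : Xinf → Z) {M : ℕ} (ρ : Fin (M + 1) → Xinf → ℝ)
    (z : Z) (R V ε : ℝ) (f : Fin (M + 1) → X → ℝ) : Prop where
  measurable : ∀ i, Measurable (f i)
  nonneg : ∀ i a, 0 ≤ f i a
  le : ∀ i a, f i a ≤ (eLpNorm (ρ i) ∞ minf).toReal * (1 + ε)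
  dist_le : ∀ i a, f i a ≠ 0 → dist (ι a) z ≤ R
  integral_eq_one : ∀ i, ∫ a, f i a ∂m = 1
  winf_le : ∀ i : Fin M, Winf (densityMeasure m (f i.castSucc)) (densityMeasure m (f i.succ)) ≤
    Winf (densityMeasure minf (ρ i.castSucc)) (densityMeasure minf (ρ i.succ)) + ENNReal.ofReal ε
  close : ∀ i (g : Z → ℝ) (K : NNReal) (B : ℝ), LipschitzWith K g → (∀ x, |g x| ≤ B) → IsTest g →
    ∫ a, |f i a - g (ι a)| ∂m ≤ ∫ a, |ρ i a - g (ιinf a)| ∂minf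
      + (∫ a, |g (ι a)| ∂m - ∫ a, |g (ιinf a)| ∂minf) + ε * (3 + 2 * K * (2 * V + 1) + 2 * B)

/-- For each precision, all but finitely many of the spaces carry densities approximating the given
ones. The masses of the conditioned chain on the members of a fine finite partition of unity are
redistributed according to the measures `m n`. -/
theorem eventually_exists_isLevelApprox (hm : ∀ n, BoundedlyFinite (m n))
    (hminf : BoundedlyFinite minf) (hreal : IsRealization m x minf xinf ι ιinf) {M : ℕ}
    {ρ : Fin (M + 1) → Xinf → ℝ} {z : Z} {r : ℝ} (hr : 0 < r)
    (hρ : ∀ i, IsBoundedProbDensity minf (ρ i))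
    (hsupp : ∀ i, ∀ᵐ a ∂minf, ρ i a ≠ 0 → dist (ιinf a) z ≤ r) {ε : ℝ} (hε : 0 < ε)
    (hε1 : ε ≤ 1) :
    ∀ᶠ n in atTop, ∃ f, IsLevelApprox (m n) minf (ι n) ιinf ρ z (7 / 4 * r)
      (minf.real (ιinf ⁻¹' Metric.closedBall z (7 / 4 * r))) ε f := by
  have hne : Nonempty Xinf := ⟨xinf⟩
  have hprob : ∀ i, IsProbabilityMeasure (densityMeasure minf (ρ i)) := fun i =>
    (hρ i).isProbabilityMeasure
  -- the partition of unity
  set δ := min (ε / 8) (r / 8) 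
  have hδ : 0 < δ := lt_min (by positivity) (by positivity)
  have hδε : δ ≤ ε / 8 := min_le_left _ _
  have hδr : δ ≤ r / 8 := min_le_right _ _
  clear_value δ
  obtain ⟨χ, c, hχc, hχ0, hχ1, hχs, hχd, hcball, hcdense, hχone⟩ :=
    exists_partition z (show r < 3 / 2 * r by linarith) hr.le hδ
  have hχR : ∀ j y, χ j y ≠ 0 → dist y z ≤ 7 / 4 * r := fun j y h => by
    linarith [dist_triangle y (c j) z, hχd j y h, hcball j]
  have hχt : ∀ j, IsTest (χ j) := fun j =>
    IsTest.of_le (hχc j) (K := 1)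
      (fun y => by rw [abs_of_nonneg (hχ0 j y)]; exact hχ1 j y) z (hχR j)
  -- the chain and the good event
  obtain ⟨Ω, _, P, Y, hP, hY, hlaw, hdist⟩ := exists_near_optimal_chain
    (fun i => densityMeasure minf (ρ i)) (ε := ENNReal.ofReal (ε / 2)) (by simpa using hε)
  have hYr : ∀ i ≤ M, ∀ᵐ ω ∂P, ∃ l, dist (ιinf (Y i ω)) (c l) ≤ δ / 2 := by
    intro i hi
    have h1 : ∀ᵐ a ∂(densityMeasure minf (ρ ⟨i, by omega⟩)), dist (ιinf a) z ≤ r := by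
      rw [densityMeasure,
        ae_withDensity_iff' (hρ _).memLp_top.1.aemeasurable.ennreal_ofReal]
      filter_upwards [hsupp ⟨i, by omega⟩] with a ha h0
      exact ha fun h' => h0 (by simp [h'])
    rw [← hlaw ⟨i, by omega⟩] at h1
    filter_upwards [ae_of_ae_map (hY i).aemeasurable h1] with ω hω using hcdense _ hω
  obtain ⟨J, E, hE, hPE, hgood⟩ := exists_good_event hY hreal.isometry_inf.continuous hYr
    (show 0 < ε / 4 by positivity)
  have hp0 : 0 < P.real E := by linarith
  set χi : ℕ → Xinf → ℝ := fun j a => χ j (ιinf a)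
  have hχi0 : ∀ j a, 0 ≤ χi j a := fun j a => hχ0 j _
  have hχi1 : ∀ j a, χi j a ≤ 1 := fun j a => hχ1 j _
  have hχis : ∀ a, ∑ j ∈ Finset.range J, χi j a ≤ 1 := fun a => hχs J _
  have hχim : ∀ j, Measurable (χi j) := fun j =>
    ((hχt j).continuous.comp hreal.isometry_inf.continuous).measurable
  have hgood1 : ∀ i ≤ M, ∀ ω ∈ E, ∑ j ∈ Finset.range J, χi j (Y i ω) = 1 := fun i hi ω hω => by
    obtain ⟨l, hl, hd⟩ := hgood ω hω i hi
    exact hχone J l hl _ hd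
  set w : ℕ → ℕ → ℝ := weight P E Y χi
  have hw0 : ∀ i j, 0 ≤ w i j := weight_nonneg hχi0
  have hint : ∀ (i : Fin (M + 1)) j,
      ∫ a, χi j a ∂(P.map (Y i)) = ∫ a, χi j a * ρ i a ∂minf := fun i j => by
    rw [hlaw i, (hρ i).integral_densityMeasure]
  have hwle : ∀ (i : Fin (M + 1)) j, w i j ≤
      (P.real E)⁻¹ * ((eLpNorm (ρ i) ∞ minf).toReal * ∫ a, χi j a ∂minf) := by
    intro i j
    refine (weight_le hχi0 hχi1 hχim hY i j).trans ?_
    refine mul_le_mul_of_nonneg_left ?_ (inv_nonneg.2 hp0.le)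
    rw [hint, ← integral_const_mul]
    refine integral_mono_ae (integrable_chi_mul hχi0 hχi1 hχim
      (hρ i).integrable j)
      (((hχt j).integrable hminf hreal.isometry_inf).const_mul _) ?_
    filter_upwards [(hρ i).ae_le] with a ha
    rw [mul_comm]
    exact mul_le_mul_of_nonneg_right ha (hχ0 j _)
  -- convergence of the masses of the partition
  have hA : ∀ j, Tendsto (fun n => ∫ a, χ j (ι n a) ∂(m n)) atTop (𝓝 (∫ a, χi j a ∂minf)) :=
    fun j => hreal.tendsto_test (hχt j)
  have hA1 : ∀ᶠ n in atTop, ∀ j < J, ∫ a, χi j a ∂minf ≠ 0 →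
      ∫ a, χi j a ∂minf ≤ (1 + ε / 4) * ∫ a, χ j (ι n a) ∂(m n) := by
    refine (Set.finite_lt_nat J).eventually_all.2 fun j _ => ?_
    by_cases h : ∫ a, χi j a ∂minf = 0
    · simp [h]
    · have hpos : 0 < ∫ a, χi j a ∂minf :=
        lt_of_le_of_ne (integral_nonneg fun a => hχ0 j _) (Ne.symm h)
      have := ((hA j).const_mul (1 + ε / 4)).eventually
        (lt_mem_nhds (show ∫ a, χi j a ∂minf < (1 + ε / 4) * ∫ a, χi j a ∂minf by nlinarith))
      exact this.mono fun n hn _ => hn.le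
  have hA2 : ∀ᶠ n in atTop,
      ∑ j ∈ Finset.range J, |∫ a, χ j (ι n a) ∂(m n) - ∫ a, χi j a ∂minf| < ε := by
    have h1 : Tendsto (fun n => ∑ j ∈ Finset.range J,
        |∫ a, χ j (ι n a) ∂(m n) - ∫ a, χi j a ∂minf|) atTop
        (𝓝 (∑ j ∈ Finset.range J, |∫ a, χi j a ∂minf - ∫ a, χi j a ∂minf|)) :=
      tendsto_finsetSum _ fun j _ => ((hA j).sub_const _).abs
    simp only [sub_self, abs_zero, Finset.sum_const_zero] at h1
    exact h1.eventually (gt_mem_nhds hε)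
  filter_upwards [hA1, hA2] with n hn1 hn2
  set χn : ℕ → X n → ℝ := fun j a => χ j (ι n a)
  have hχn0 : ∀ j a, 0 ≤ χn j a := fun j a => hχ0 j _
  have hχn1 : ∀ j a, χn j a ≤ 1 := fun j a => hχ1 j _
  have hχns : ∀ a, ∑ j ∈ Finset.range J, χn j a ≤ 1 := fun a => hχs J _
  have hχnm : ∀ j, Measurable (χn j) := fun j =>
    ((hχt j).continuous.comp (hreal.isometry n).continuous).measurable
  have hχni : ∀ j, Integrable (χn j) (m n) := fun j => (hχt j).integrable (hm n) (hreal.isometry n)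
  have hBpos : ∀ (i : Fin (M + 1)) j, w i j ≠ 0 → ∫ a, χi j a ∂minf ≠ 0 := fun i j h h' => by
    have h1 := hwle i j
    rw [h', mul_zero, mul_zero] at h1
    exact h (le_antisymm h1 (hw0 i j))
  have hApos : ∀ (i : Fin (M + 1)), ∀ j < J, w i j ≠ 0 → ∫ a, χn j a ∂(m n) ≠ 0 :=
    fun i j hj h h' => by
      have h1 := hn1 j hj (hBpos i j h)
      have h2 : 0 ≤ ∫ a, χi j a ∂minf := integral_nonneg fun a => hχ0 j _
      change ∫ a, χ j (ι n a) ∂(m n) = 0 at h'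
      rw [h', mul_zero] at h1
      exact hBpos i j h (le_antisymm h1 h2)
  have hsumw : ∀ i : Fin (M + 1), ∑ j ∈ Finset.range J, w i j = 1 := fun i =>
    sum_weight hχi0 hχi1 hχim hY hE hp0.ne'
      (hgood1 i (Nat.lt_succ_iff.1 i.2))
  refine ⟨fun i => smear (m n) χn J (w i), fun i => measurable_smear hχnm _,
    fun i => smear_nonneg hχn0 (hw0 i), fun i => ?_, fun i a ha => ?_, fun i => ?_,
    fun i => ?_, fun i g K B hgK hgB hgt => ?_⟩
  · -- the bound: the quotient of masses and the conditioning cost at most a factor `1 + ε`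
    set C := (eLpNorm (ρ i) ∞ minf).toReal
    have hC : 0 ≤ C := ENNReal.toReal_nonneg
    refine smear_le hχn0 hχns (by positivity) fun j hj => ?_
    by_cases h : w i j = 0
    · rw [h, zero_div]; positivity
    · have hA0 : 0 < ∫ a, χn j a ∂(m n) :=
        lt_of_le_of_ne (integral_nonneg fun a => hχ0 j _) (Ne.symm (hApos i j hj h))
      rw [div_le_iff₀ hA0]
      refine (hwle i j).trans ?_
      rw [inv_mul_le_iff₀ hp0]
      have h1 := hn1 j hj (hBpos i j h)
      calc C * ∫ a, χi j a ∂minf ≤ C * ((1 + ε / 4) * ∫ a, χn j a ∂(m n)) :=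
            mul_le_mul_of_nonneg_left h1 hC
        _ = (1 + ε / 4) * (C * ∫ a, χn j a ∂(m n)) := by ring
        _ ≤ (P.real E * (1 + ε)) * (C * ∫ a, χn j a ∂(m n)) := by
            refine mul_le_mul_of_nonneg_right ?_ (mul_nonneg hC hA0.le)
            nlinarith
        _ = _ := by ring
  · obtain ⟨j, hj⟩ := exists_of_smear_ne_zero ha
    exact hχR j _ hj
  · rw [integral_smear hχni (hApos i), hsumw]
  · have hi := i.2
    have hpair0 : ∀ j k, 0 ≤ pairWeight P E Y χi i j k := pairWeight_nonneg hχi0 i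
    have hsum1 : ∀ j, ∑ k ∈ Finset.range J, pairWeight P E Y χi i j k = w i j :=
      sum_pairWeight_right hχi0 hχi1 hχim hY hE
        (hgood1 (i + 1) (by omega))
    have hsum2 : ∀ k, ∑ j ∈ Finset.range J, pairWeight P E Y χi i j k = w (i + 1) k :=
      sum_pairWeight_left hχi0 hχi1 hχim hY hE
        (hgood1 i (by omega))
    -- only the weights with both indices below `J` enter the plan
    let a' : ℕ → ℕ → ℝ := fun j k => if j < J ∧ k < J then pairWeight P E Y χi i j k else 0
    have ha' : ∀ j k, a' j k ≠ 0 → j < J ∧ k < J ∧ pairWeight P E Y χi i j k ≠ 0 := by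
      intro j k h
      by_cases hjk : j < J ∧ k < J
      · exact ⟨hjk.1, hjk.2, by simpa only [a', hjk, and_self, if_true] using h⟩
      · simp only [a', hjk, if_false, ne_eq, not_true] at h
    have heq : ∀ j < J, ∀ k < J, a' j k = pairWeight P E Y χi i j k := fun j hj k hk => by
      simp only [a', hj, hk, and_self, if_true]
    refine Winf_smear_le (a := a') hχn0 hχnm hχni (fun j k => ?_) (hw0 _) (hw0 _)
      (fun j hj => ?_) (fun k hk => ?_) (fun j k h => ?_) (fun j k h u v hu hv => ?_)
    · by_cases hjk : j < J ∧ k < J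
      · simpa only [a', hjk, and_self, if_true] using hpair0 j k
      · simp only [a', hjk, if_false, le_refl]
    · rw [Finset.sum_congr rfl fun k hk => heq j hj k (Finset.mem_range.1 hk)]
      exact hsum1 j
    · rw [Finset.sum_congr rfl fun j hj => heq j (Finset.mem_range.1 hj) k hk]
      exact hsum2 k
    · obtain ⟨hj, hk, h⟩ := ha' j k h
      have hpos : 0 < pairWeight P E Y χi i j k := lt_of_le_of_ne (hpair0 j k) (Ne.symm h)
      have h1 : pairWeight P E Y χi i j k ≤ w i j := by
        rw [← hsum1 j]
        exact Finset.single_le_sum (f := fun k => pairWeight P E Y χi i j k)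
          (fun k _ => hpair0 j k) (Finset.mem_range.2 hk)
      have h2 : pairWeight P E Y χi i j k ≤ w (i + 1) k := by
        rw [← hsum2 k]
        exact Finset.single_le_sum (f := fun j => pairWeight P E Y χi i j k)
          (fun j _ => hpair0 j k) (Finset.mem_range.2 hj)
      exact ⟨hApos i.castSucc j hj (hpos.trans_le h1).ne',
        hApos i.succ k hk (hpos.trans_le h2).ne'⟩
    · obtain ⟨_, _, h⟩ := ha' j k h
      obtain ⟨b, b', hb, hb', hbb⟩ := exists_of_pairWeight_ne_zero
        (Q := fun b b' => edist b b' ≤ Winf (densityMeasure minf (ρ i.castSucc))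
          (densityMeasure minf (ρ i.succ)) + ENNReal.ofReal (ε / 2)) h (hdist i)
      have hsmall : ∀ {y : Z} {j}, χ j y ≠ 0 → edist y (c j) ≤ ENNReal.ofReal (ε / 8) :=
        fun {y j} h' => by
          rw [edist_dist]
          exact ENNReal.ofReal_le_ofReal ((hχd j y h').le.trans hδε)
      rw [← (hreal.isometry n).edist_eq]
      have hsplit : ENNReal.ofReal ε = ENNReal.ofReal (ε / 2) + (ENNReal.ofReal (ε / 8) +
          ENNReal.ofReal (ε / 8) + (ENNReal.ofReal (ε / 8) + ENNReal.ofReal (ε / 8))) := by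
        rw [← ENNReal.ofReal_add (by positivity) (by positivity),
          ← ENNReal.ofReal_add (by positivity) (by positivity),
          ← ENNReal.ofReal_add (by positivity) (by positivity)]
        congr 1; ring
      rw [hsplit, ← add_assoc]
      calc edist (ι n u) (ι n v)
          ≤ edist (ι n u) (ιinf b) + edist (ιinf b) (ιinf b') + edist (ιinf b') (ι n v) :=
            edist_triangle4 _ _ _ _
        _ ≤ (edist (ι n u) (c j) + edist (ιinf b) (c j)) + edist b b' +
            (edist (ιinf b') (c k) + edist (ι n v) (c k)) := by
          rw [hreal.isometry_inf.edist_eq]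
          gcongr
          · exact edist_triangle_right _ _ _
          · exact edist_triangle_right _ _ _
        _ ≤ (ENNReal.ofReal (ε / 8) + ENNReal.ofReal (ε / 8)) + (Winf _ _ + ENNReal.ofReal (ε / 2))
            + (ENNReal.ofReal (ε / 8) + ENNReal.ofReal (ε / 8)) := by
          gcongr
          exacts [hsmall hu, hsmall hb, hsmall hb', hsmall hv]
        _ = _ := by
          rw [add_comm (ENNReal.ofReal (ε / 8) + ENNReal.ofReal (ε / 8)), add_assoc]
  · have hv : ∀ j y, χ j y ≠ 0 → |g y - g (c j)| ≤ K * δ := fun j y h => by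
      rw [← Real.dist_eq]
      exact (hgK.dist_le_mul _ _).trans
        (mul_le_mul_of_nonneg_left (hχd j y h).le K.coe_nonneg)
    have key := integral_abs_smear_sub_le_of_near (m := m n) (m' := minf) (χ := χn) (χ' := χi)
      (J := J) (w := w i) (v := fun j => g (c j)) (g := fun a => g (ι n a))
      (g' := fun a => g (ιinf a)) (ρ := ρ i) (κ := K * δ) (K := B)
      hχn0 hχn1 hχns hχnm hχni (hApos i)
      (hgt.integrable (hm n) (hreal.isometry n)) (fun j a => hv j _)
      hχi0 hχi1 hχis hχim
      (fun j => (hχt j).integrable hminf hreal.isometry_inf) (hρ i).integrable (hρ i).nonneg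
      (hgt.integrable hminf hreal.isometry_inf) (fun j a => hv j _) (fun j => hgB _)
    have h1 := sum_abs_weight_sub_le hχi0 hχi1 hχis
      hχim hY hE hp0.ne' (hgood1 i (Nat.lt_succ_iff.1 i.2))
    have h2 := le_sum_integral_map hχi0 hχi1
      hχim hY hE hp0.ne' (hgood1 i (Nat.lt_succ_iff.1 i.2))
    simp only [hint] at h1 h2
    have h3 := sum_integral_pou_le hminf hreal.isometry_inf hχt (hχs J) hχR
    set V := minf.real (ιinf ⁻¹' Metric.closedBall z (7 / 4 * r))
    set SB := ∑ j ∈ Finset.range J, ∫ a, χi j a ∂minf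
    set SA := ∑ j ∈ Finset.range J, ∫ a, χn j a ∂(m n)
    set SD := ∑ j ∈ Finset.range J, |∫ a, χn j a ∂(m n) - ∫ a, χi j a ∂minf|
    have hSD : SD < ε := hn2
    have h4 : SA ≤ SB + SD := by
      simp only [SA, SB, SD, ← Finset.sum_add_distrib]
      exact Finset.sum_le_sum fun j _ => by
        linarith [le_abs_self (∫ a, χn j a ∂(m n) - ∫ a, χi j a ∂minf)]
    have hB0 : 0 ≤ B := (abs_nonneg _).trans (hgB z)
    have hV0 : 0 ≤ V := measureReal_nonneg
    have h5 : 2 * (K * δ) * (SA + SB) ≤ ε * (2 * K * (2 * V + 1)) :=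
      calc 2 * (K * δ) * (SA + SB) ≤ 2 * (K * ε) * (2 * V + 1) := by
            have : SA + SB ≤ 2 * V + 1 := by linarith [show SB ≤ V from h3]
            have hδε' : δ ≤ ε := by linarith
            have hSA : 0 ≤ SA := Finset.sum_nonneg fun j _ => integral_nonneg (hχn0 j)
            have hSB : 0 ≤ SB := Finset.sum_nonneg fun j _ => integral_nonneg (hχi0 j)
            have hSAB : 0 ≤ SA + SB := add_nonneg hSA hSB
            gcongr
        _ = _ := by ring
    have h6 : 2 * B * SD ≤ ε * (2 * B) := by
      rw [mul_comm ε]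
      exact mul_le_mul_of_nonneg_left hSD.le (by linarith)
    rw [(hρ i).integral_eq_one] at key
    have h7 : (3 : ℝ) * (1 - P.real E) ≤ ε * 3 := by linarith
    linarith

end Level


/-! ### Diagonal choice of the precision -/

/-- Properties that hold eventually in `n` for each `k` hold eventually along some `k n → ∞`. -/
lemma exists_diagonal {P : ℕ → ℕ → Prop} (h : ∀ k, ∀ᶠ n in atTop, P k n) :
    ∃ k : ℕ → ℕ, Tendsto k atTop atTop ∧ ∀ᶠ n in atTop, P (k n) n := by
  choose N hN using fun k => eventually_atTop.1 (h k)
  refine ⟨fun n => Nat.findGreatest (fun k => N k ≤ n) n, tendsto_atTop.2 fun b => ?_, ?_⟩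
  · filter_upwards [eventually_ge_atTop (max b (N b))] with n hn
    exact Nat.le_findGreatest ((le_max_left _ _).trans hn) ((le_max_right _ _).trans hn)
  · filter_upwards [eventually_ge_atTop (N 0)] with n hn
    exact hN _ _ (Nat.findGreatest_spec (P := fun k => N k ≤ n) (Nat.zero_le n) hn)

/-- A ball of positive mass carries a bounded probability density which is supported in a smaller
concentric ball. -/
lemma exists_density_of_pos {X Z : Type*} [MetricSpace X] [MeasurableSpace X] [BorelSpace X]
    [MetricSpace Z] {m : Measure X} (hm : BoundedlyFinite m) {ι : X → Z} (hι : Isometry ι) {z : Z}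
    {R : ℝ} (hpos : 0 < m (ι ⁻¹' Metric.ball z R)) :
    ∃ f : X → ℝ, Measurable f ∧ (∀ a, 0 ≤ f a) ∧ (∃ C, ∀ a, f a ≤ C) ∧
      (∃ s < R, ∀ a, f a ≠ 0 → dist (ι a) z ≤ s) ∧ ∫ a, f a ∂m = 1 := by
  obtain ⟨s, hs, hms⟩ : ∃ s < R, m (ι ⁻¹' Metric.closedBall z s) ≠ 0 := by
    by_contra! h
    refine hpos.ne' (measure_mono_null (t := ⋃ k : ℕ,
      ι ⁻¹' Metric.closedBall z (R - 1 / ((k : ℝ) + 1))) (fun a ha => ?_)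
      (measure_iUnion_null fun k => h _ (sub_lt_self R Nat.one_div_pos_of_nat)))
    obtain ⟨k, hk⟩ := exists_nat_one_div_lt (sub_pos.2 (Metric.mem_ball.1 ha))
    exact Set.mem_iUnion.2 ⟨k, Metric.mem_closedBall.2 (by linarith)⟩
  set S := ι ⁻¹' Metric.closedBall z s
  have hS : MeasurableSet S := (Metric.isClosed_closedBall.preimage hι.continuous).measurableSet
  have hreal : m.real S ≠ 0 :=
    (ENNReal.toReal_pos hms (hm.lt_top_preimage_closedBall hι z s).ne).ne'
  have hinv : 0 ≤ (m.real S)⁻¹ := inv_nonneg.2 measureReal_nonneg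
  refine ⟨S.indicator fun _ => (m.real S)⁻¹, measurable_const.indicator hS,
    Set.indicator_nonneg fun _ _ => hinv,
    ⟨(m.real S)⁻¹, Set.indicator_le_self' fun _ _ => hinv⟩, ⟨s, hs, fun a ha => ?_⟩, ?_⟩
  · exact (Set.indicator_apply_ne_zero.1 ha).1
  · rw [integral_indicator_const _ hS, smul_eq_mul, mul_inv_cancel₀ hreal]

end PMGH

theorem mainTheorem7 {X : ℕ → Type*} {Xinf : Type*} {Z : Type*}
    [∀ n, MetricSpace (X n)] [∀ n, CompleteSpace (X n)]
    [∀ n, TopologicalSpace.SeparableSpace (X n)]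
    [∀ n, MeasurableSpace (X n)] [∀ n, BorelSpace (X n)]
    [MetricSpace Xinf] [CompleteSpace Xinf] [TopologicalSpace.SeparableSpace Xinf]
    [MeasurableSpace Xinf] [BorelSpace Xinf]
    [MetricSpace Z] [CompleteSpace Z] [TopologicalSpace.SeparableSpace Z]
    [MeasurableSpace Z] [BorelSpace Z]
    (m : ∀ n, Measure (X n)) (x : ∀ n, X n) (minf : Measure Xinf) (xinf : Xinf)
    (hm : ∀ n, PMGH.BoundedlyFinite (m n)) (hminf : PMGH.BoundedlyFinite minf)
    (ι : ∀ n, X n → Z) (ιinf : Xinf → Z)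
    (hreal : PMGH.IsRealization m x minf xinf ι ιinf)
    (M : ℕ) (ρ : Fin (M + 1) → Xinf → ℝ) (z : Z) (r : ℝ) (hr : 0 < r)
    (hρ : ∀ i, PMGH.IsBoundedProbDensity minf (ρ i))
    (hsupp : ∀ i, ιinf '' PMGH.essSupport minf (ρ i) ⊆ Metric.closedBall z r) :
    (∀ᶠ n in atTop, 0 < m n (ι n ⁻¹' Metric.ball z (2 * r))) ∧
    ∃ ρn : Fin (M + 1) → ∀ n, X n → ℝ,
      (∀ i n, MemLp (ρn i n) ∞ (m n)) ∧
      (∀ n, 0 < m n (ι n ⁻¹' Metric.ball z (2 * r)) → ∀ i,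
        PMGH.IsBoundedProbDensity (m n) (ρn i n) ∧
        ι n '' PMGH.essSupport (m n) (ρn i n) ⊆ Metric.ball z (2 * r)) ∧
      (∀ i : Fin M,
        limsup (fun n => PMGH.Winf (PMGH.densityMeasure (m n) (ρn i.castSucc n))
          (PMGH.densityMeasure (m n) (ρn i.succ n))) atTop ≤
        PMGH.Winf (PMGH.densityMeasure minf (ρ i.castSucc))
          (PMGH.densityMeasure minf (ρ i.succ))) ∧
      (∀ i, limsup (fun n => eLpNorm (ρn i n) ∞ (m n)) atTop ≤ eLpNorm (ρ i) ∞ minf) ∧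
      (∀ i, ∀ q : ℝ≥0∞, 1 ≤ q → q < ∞ →
        PMGH.StrongLpConv m minf ι ιinf q (ρn i) (ρ i)) := by
  have hsupp' : ∀ i, ∀ᵐ a ∂minf, ρ i a ≠ 0 → dist (ιinf a) z ≤ r := fun i =>
    PMGH.ae_mem_of_essSupport_subset (hρ i).memLp_top.1 (hsupp i)
  let ε : ℕ → ℝ := fun k => 1 / ((k : ℝ) + 1)
  have hε : ∀ k, 0 < ε k := fun k => Nat.one_div_pos_of_nat
  have hε1 : ∀ k, ε k ≤ 1 := fun k => by
    have : (1 : ℝ) ≤ (k : ℝ) + 1 := by linarith [(Nat.cast_nonneg k : (0 : ℝ) ≤ k)]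
    exact (div_le_one (by linarith)).2 this
  set V := minf.real (ιinf ⁻¹' Metric.closedBall z (7 / 4 * r))
  let L : ℕ → ∀ n, (Fin (M + 1) → X n → ℝ) → Prop := fun k n f =>
    PMGH.IsLevelApprox (m n) minf (ι n) ιinf ρ z (7 / 4 * r) V (ε k) f
  obtain ⟨k, hk, hkL⟩ := PMGH.exists_diagonal (P := fun k n => ∃ f, L k n f) fun k =>
    PMGH.eventually_exists_isLevelApprox hm hminf hreal hr hρ hsupp' (hε k) (hε1 k)
  have hεk : Tendsto (fun n => ε (k n)) atTop (𝓝 0) :=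
    tendsto_one_div_add_atTop_nhds_zero_nat.comp hk
  -- The densities at precision `ε (k n)`; where these do not exist, an arbitrary density.
  have hchoice : ∀ n, ∃ f : Fin (M + 1) → X n → ℝ, (∀ i, Measurable (f i)) ∧ (∀ i a, 0 ≤ f i a) ∧
      (∀ i, ∃ C, ∀ a, f i a ≤ C) ∧
      (∀ i, ∃ s < 2 * r, ∀ a, f i a ≠ 0 → dist (ι n a) z ≤ s) ∧
      (0 < m n (ι n ⁻¹' Metric.ball z (2 * r)) → ∀ i, ∫ a, f i a ∂(m n) = 1) ∧
      ((∃ f, L (k n) n f) → L (k n) n f) := by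
    intro n
    by_cases h : ∃ f, L (k n) n f
    · obtain ⟨f, hf⟩ := h
      exact ⟨f, hf.measurable, hf.nonneg, fun i => ⟨_, hf.le i⟩,
        fun i => ⟨7 / 4 * r, by linarith, hf.dist_le i⟩, fun _ => hf.integral_eq_one, fun _ => hf⟩
    by_cases hpos : 0 < m n (ι n ⁻¹' Metric.ball z (2 * r))
    · obtain ⟨f, h1, h2, h3, h4, h5⟩ := PMGH.exists_density_of_pos (hm n) (hreal.isometry n) hpos
      exact ⟨fun _ => f, fun _ => h1, fun _ => h2, fun _ => h3, fun _ => h4, fun _ _ => h5,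
        fun h' => absurd h' h⟩
    · exact ⟨fun _ _ => 0, fun _ => measurable_const, fun _ _ => le_rfl,
        fun _ => ⟨0, fun _ => le_rfl⟩, fun _ => ⟨0, by linarith, fun a ha => absurd rfl ha⟩,
        fun h' => absurd h' hpos, fun h' => absurd h' h⟩
  choose f hfm hf0 hfC hfs hf1 hfL using hchoice
  have hL : ∀ᶠ n in atTop, L (k n) n (f n) := hkL.mono fun n hn => hfL n hn
  refine ⟨hL.mono fun n hn => ?_, fun i n => f n i, fun i n => ?_, fun n hn i => ⟨?_, ?_⟩,
    fun i => ?_, fun i => ?_, fun i q hq1 hq => ?_⟩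
  · -- a density supported in a null set would have zero integral
    by_contra h
    have h0 : m n (ι n ⁻¹' Metric.ball z (2 * r)) = 0 := by simpa using h
    have h1 : ∫ a, f n 0 a ∂(m n) = 0 := by
      refine integral_eq_zero_of_ae ?_
      filter_upwards [measure_eq_zero_iff_ae_notMem.1 h0] with a ha
      by_contra hne
      exact ha (Metric.mem_ball.2 ((hn.dist_le 0 a hne).trans_lt (by linarith)))
    rw [hn.integral_eq_one 0] at h1
    exact one_ne_zero h1
  · obtain ⟨C, hC⟩ := hfC n i
    exact memLp_top_of_bound (hfm n i).aestronglyMeasurable C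
      (ae_of_all _ fun a => by rw [Real.norm_of_nonneg (hf0 n i a)]; exact hC a)
  · obtain ⟨C, hC⟩ := hfC n i
    exact PMGH.isBoundedProbDensity_of_bounded (hfm n i) (hf0 n i) hC (hf1 n hn i)
  · obtain ⟨s, hs, hfs'⟩ := hfs n i
    exact (PMGH.essSupport_subset (hfm n i) (hreal.isometry n).continuous
      Metric.isClosed_closedBall hfs').trans (Metric.closedBall_subset_ball hs)
  · have hlim : Tendsto (fun n => PMGH.Winf (PMGH.densityMeasure minf (ρ i.castSucc))
        (PMGH.densityMeasure minf (ρ i.succ)) + ENNReal.ofReal (ε (k n))) atTop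
        (𝓝 (PMGH.Winf (PMGH.densityMeasure minf (ρ i.castSucc))
          (PMGH.densityMeasure minf (ρ i.succ)) + ENNReal.ofReal 0)) :=
      tendsto_const_nhds.add ((ENNReal.continuous_ofReal.tendsto 0).comp hεk)
    rw [ENNReal.ofReal_zero, add_zero] at hlim
    exact (limsup_le_limsup (hL.mono fun n hn => hn.winf_le i)).trans hlim.limsup_eq.le
  · have hlim : Tendsto (fun n => ENNReal.ofReal ((eLpNorm (ρ i) ∞ minf).toReal * (1 + ε (k n))))
        atTop (𝓝 (ENNReal.ofReal ((eLpNorm (ρ i) ∞ minf).toReal * (1 + 0)))) :=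
      (ENNReal.continuous_ofReal.tendsto _).comp ((hεk.const_add 1).const_mul _)
    rw [add_zero, mul_one, ENNReal.ofReal_toReal (hρ i).memLp_top.2.ne] at hlim
    refine (limsup_le_limsup (hL.mono fun n hn => ?_)).trans hlim.limsup_eq.le
    rw [eLpNorm_exponent_top]
    exact eLpNormEssSup_le_of_ae_bound
      (ae_of_all _ fun a => by rw [Real.norm_of_nonneg (hf0 n i a)]; exact hn.le i a)
  · set C := (eLpNorm (ρ i) ∞ minf).toReal
    have hC : 0 ≤ C := ENNReal.toReal_nonneg
    refine PMGH.strongLpConv_of_l1Close hm hminf hreal (A := C * 2) (R := 2 * r) (z := z)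
      (by positivity) (hρ i).memLp_top.1 (hρ i).nonneg ?_ ?_ (fun n => hfm n i)
      (fun n => hf0 n i) (fun n => hfC n i) ?_ (fun n a ha => ?_) ?_ hq1 hq
    · filter_upwards [(hρ i).ae_le] with a ha
      linarith
    · filter_upwards [hsupp' i] with a ha h
      linarith [ha h]
    · filter_upwards [hL] with n hn a
      exact (hn.le i a).trans (mul_le_mul_of_nonneg_left (by linarith [hε1 (k n)]) hC)
    · obtain ⟨s, hs, hfs'⟩ := hfs n i
      exact (hfs' a ha).trans hs.le
    · intro g K hgK hgt η hη
      obtain ⟨B, hB⟩ := hgt.bounded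
      have hlim : Tendsto (fun n => ∫ a, |ρ i a - g (ιinf a)| ∂minf
          + (∫ a, |g (ι n a)| ∂(m n) - ∫ a, |g (ιinf a)| ∂minf)
          + ε (k n) * (3 + 2 * K * (2 * V + 1) + 2 * B)) atTop
          (𝓝 (∫ a, |ρ i a - g (ιinf a)| ∂minf
            + (∫ a, |g (ιinf a)| ∂minf - ∫ a, |g (ιinf a)| ∂minf)
            + 0 * (3 + 2 * K * (2 * V + 1) + 2 * B))) :=
        (((hreal.tendsto_test hgt.abs).sub_const _).const_add _).add (hεk.mul_const _)
      rw [sub_self, zero_mul, add_zero, add_zero] at hlim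
      filter_upwards [hL, hlim.eventually (gt_mem_nhds (lt_add_of_pos_right _ hη))] with n hn hn'
      exact (hn.close i g K B hgK hB hgt).trans hn'.le
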